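/- Let $M$ be a closed connected oriented smooth 3-manifold and let $X$ be a $C^\infty$ vector field on $M$ whose flow $X^t$ is a transversally oriented Anosov flow: there is a continuous $X^t$-invariant splitting $TM=\langle X\rangle\oplus E^s\oplus E^u$ into orientable line bundles, a continuous norm on $TM$ and constants $A,C>0$ with $\|X^t_*e\|\le Ae^{-Ct}\|e\|$ for $e\in E^s$ and $\|X^t_*e\|\ge A^{-1}e^{Ct}\|e\|$ for $e\in E^u$, for all $t\ge 0$. *Contact geometry.* A contact form is a $C^\infty$ 1-form $\alpha$ with $\alpha\wedge d\alpha$ nowhere zero; it is positive (negative) if $\alpha\wedge d\alpha$ is a positive (negative) volume form, and then its kernel is a positive (negative) contact structure. Its Reeb vector field $R_\alpha$ is given by $\alpha(R_\alpha)=1$, $d\alpha(R_\alpha,\cdot)=0$. A basis of $\ker\alpha$ is co-oriented if it is positive for the orientation of $\ker\alpha$ given by the area form $d\alpha|_{\ker\alpha}$. A supporting bi-contact structure for $X$ is a pair $(\xi_-,\xi_+)$ of transverse contact structures, $\xi_-$ negative and $\xi_+$ positive, with $X\in\xi_-\cap\xi_+$. A positive contact form $\alpha_+$ is supporting if there is a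 $\xi_-$ such that $(\xi_-,\ker\alpha_+)$ is a supporting bi-contact structure for $X$; a supporting $\alpha_+$ is strongly adapted to $X$ if $\langle X,R_{\alpha_+}\rangle$ is a negative contact structure. *Induced norms and rates.* A 1-form $\beta$ with $\beta(X)=0$ is written uniquely as $\beta=\beta_u-\beta_s$, where $\beta_u$ vanishes on $\langle X\rangle\oplus E^s$ and $\beta_s$ vanishes on $\langle X\rangle\oplus E^u$; if neither $\beta_u$ nor $\beta_s$ vanishes at any point, it induces the norms $|\beta_u|$ on $E^u$ and $|\beta_s|$ on $E^s$. A norm on $E^s\oplus E^u$ is projectively adapted if for some $C>0$ one has $\|X^t_*e_s\|/\|X^t_*e_u\|\le e^{-Ct}\|e_s\|/\|e_u\|$ for all $t\ge0$, $e_s\in E^s_p$, $0\ne e_u\in E^u_p$, $p\in M$. A supporting form $\alpha_+=\alpha_u-\alpha_s$ is adapted if $R_{\alpha_+}$ lies in the open second or fourth quadrant of $TM/\langle X\rangle\simeq E^s\oplus E^u$ with coordinates $(\alpha_s,\alpha_u)$, that is, $\alpha_s(R_{\alpha_+})\,\alpha_u(R_{\alpha_+})<0$ everywhere. **Proposition.**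 Let $\alpha_+$ be an adapted supporting contact form for $X$. Then there are functions $r_u,r_s:M\to\mathbb R$, the expansion rates induced from $\alpha_+$, with $\mathcal L_X\alpha_u=r_u\alpha_u$, $\mathcal L_X\alpha_s=r_s\alpha_s$ and $r_s<0<r_u$, and $\ln r_u$, $\ln(-r_s)$ are differentiable along the flow. Moreover the following are equivalent: 1. $\alpha_+$ is strongly adapted to $X$; 2. $(\langle X,R_{\alpha_+}\rangle,\ker\alpha_+)$ is a supporting bi-contact structure for $X$; 3. $\mathcal L_X\alpha_+$ is a negative contact form; 4. the norm that $\mathcal L_X\alpha_+$ induces on $E^s\oplus E^u$ is projectively adapted; 5. $(X,[R_{\alpha_+},X])$ is a co-oriented basis of $\ker\alpha_+$ at every point; 6. $(R_{\alpha_+},[X,R_{\alpha_+}],X)$ is an oriented basis of $TM$ at every point; 7. $(\mathcal L_X\alpha_+)([R_{\alpha_+},X])>0$ everywhere; 8. $r_u+X\cdot\ln r_u>r_s+X\cdot\ln(-r_s)$ everywhere, where $X\cdot$ is the derivative along $X$. -/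

import Mathlib

open scoped Manifold ContDiff Topology Bundle

noncomputable section

namespace AnosovContact

/-- The model space of a 3-manifold. -/
abbrev R3 : Type := EuclideanSpace ℝ (Fin 3)

section Basic

variable {M : Type*} [TopologicalSpace M] [ChartedSpace R3 M]

instance (p : M) : FiniteDimensional ℝ (TangentSpace (𝓡 3) p) :=
  inferInstanceAs (FiniteDimensional ℝ R3)

instance (p : M) : T2Space (TangentSpace (𝓡 3) p) :=
  inferInstanceAs (T2Space R3)

variable (M) in
/-- (Not necessarily continuous) vector fields on `M`. -/
abbrev VecField : Type _ := ∀ p : M, TangentSpace (𝓡 3) p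

variable (M) in
/-- (Not necessarily continuous) differential 1-forms on `M`. -/
abbrev OneForm : Type _ := ∀ p : M, TangentSpace (𝓡 3) p →L[ℝ] ℝ

variable (M) in
/-- (Not necessarily continuous) fields of linear subspaces of the tangent spaces of `M`. -/
abbrev SubspaceField : Type _ := ∀ p : M, Submodule ℝ (TangentSpace (𝓡 3) p)

/-- The Lie bracket `[V, W]` of vector fields. -/
abbrev bracket (V W : VecField M) : VecField M := VectorField.mlieBracket (𝓡 3) V W

/-- The pull-back `f^* α` of a 1-form by a map `f : M → M`. -/
def pullback (f : M → M) (α : OneForm M) : OneForm M :=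
  fun p => (α (f p)).comp (mfderiv (𝓡 3) (𝓡 3) f p)

/-- The coordinate expression of the 1-form `α` in the preferred chart at `p`. -/
def coordForm (α : OneForm M) (p : M) (y : R3) : R3 →L[ℝ] ℝ :=
  (α ((extChartAt (𝓡 3) p).symm y)).comp
    (mfderiv 𝓘(ℝ, R3) (𝓡 3) (extChartAt (𝓡 3) p).symm y)

/-- The exterior derivative of a 1-form, `dα_p (v, w)`, computed in the preferred chart at `p` by
`dα (v, w) = (D_v α) w - (D_w α) v`, that is `d (∑ aᵢ dxᵢ) = ∑ daᵢ ∧ dxᵢ`. -/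
def extD (α : OneForm M) (p : M) (v w : TangentSpace (𝓡 3) p) : ℝ :=
  let D := fderiv ℝ (coordForm α p) (extChartAt (𝓡 3) p p)
  let v' : R3 := mfderiv (𝓡 3) 𝓘(ℝ, R3) (extChartAt (𝓡 3) p) p v
  let w' : R3 := mfderiv (𝓡 3) 𝓘(ℝ, R3) (extChartAt (𝓡 3) p) p w
  D v' w' - D w' v'

/-- The value of the 3-form `α ∧ dα` at `p` on the triple `v`. -/
def wedgeExtD (α : OneForm M) (p : M) (v : Fin 3 → TangentSpace (𝓡 3) p) : ℝ :=
  α p (v 0) * extD α p (v 1) (v 2) + α p (v 1) * extD α p (v 2) (v 0)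
    + α p (v 2) * extD α p (v 0) (v 1)

/-- `v` is a positively oriented basis of the tangent space for the orientation `o`. -/
def IsPosBasis {p : M} (o : Orientation ℝ (TangentSpace (𝓡 3) p) (Fin 3))
    (v : Fin 3 → TangentSpace (𝓡 3) p) : Prop :=
  ∃ b : Module.Basis (Fin 3) ℝ (TangentSpace (𝓡 3) p), ⇑b = v ∧ b.orientation = o

/-- `φ` is the smooth flow generated by `X`. -/
structure IsFlowOf (X : VecField M) (φ : ℝ → M → M) : Prop where
  smooth : ContMDiff (𝓘(ℝ, ℝ).prod (𝓡 3)) (𝓡 3) ∞ (fun q : ℝ × M => φ q.1 q.2)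
  zero : ∀ p, φ 0 p = p
  add : ∀ s t p, φ (s + t) p = φ s (φ t p)
  velocity : ∀ p, IsMIntegralCurve (I := 𝓡 3) (fun t => φ t p) X

/-- The Lie derivative `L_X α`, the derivative at `t = 0` of the pull-backs of `α` by the flow
`φ` of `X`. -/
def lieD (φ : ℝ → M → M) (α : OneForm M) : OneForm M :=
  fun p => deriv (fun t : ℝ => pullback (φ t) α p) 0

/-- `r` is the expansion rate of `β`: `L_X β = r β`, including the existence of the Lie
derivative along the flow (`β` need not be smooth). -/
def IsExpansionRate (φ : ℝ → M → M) (β : OneForm M) (r : M → ℝ) : Prop :=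
  ∀ p, HasDerivAt (fun t : ℝ => pullback (φ t) β p) (r p • β p) 0

/-- `g = X · f` is the derivative of the function `f` along the flow `φ` of `X`. -/
def IsFlowDeriv (φ : ℝ → M → M) (f g : M → ℝ) : Prop :=
  ∀ p, HasDerivAt (fun t : ℝ => f (φ t p)) (g p) 0

end Basic

variable {M : Type*} [TopologicalSpace M] [ChartedSpace R3 M] [IsManifold (𝓡 3) ∞ M]

/-- `C^∞` vector fields. -/
def IsSmoothField (V : VecField M) : Prop :=
  ContMDiff (𝓡 3) (𝓡 3).tangent ∞ (fun p => (⟨p, V p⟩ : TangentBundle (𝓡 3) M))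

/-- Continuous vector fields. -/
def IsContField (V : VecField M) : Prop :=
  Continuous (fun p => (⟨p, V p⟩ : TangentBundle (𝓡 3) M))

/-- `C^∞` 1-forms, as sections of the cotangent bundle. -/
def IsSmoothForm (α : OneForm M) : Prop :=
  ContMDiff (𝓡 3) ((𝓡 3).prod 𝓘(ℝ, R3 →L[ℝ] ℝ)) ∞
    (fun p => (⟨p, α p⟩ : Bundle.TotalSpace (R3 →L[ℝ] ℝ)
      (fun x : M => TangentSpace (𝓡 3) x →L[ℝ] Bundle.Trivial M ℝ x)))

variable (M) in
/-- An orientation of the manifold `M`: an orientation of each tangent space such that a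
continuous triple of vector fields that is a positively oriented basis at a point is one at all
nearby points. -/
structure MOrientation where
  at_ : ∀ p : M, Orientation ℝ (TangentSpace (𝓡 3) p) (Fin 3)
  isOpen_pos : ∀ V : Fin 3 → VecField M, (∀ i, IsContField (V i)) →
    IsOpen {p : M | IsPosBasis (at_ p) (fun i => V i p)}

/-- Positive contact forms: `α ∧ dα` is a positive volume form. -/
def IsPosContactForm (o : MOrientation M) (α : OneForm M) : Prop :=
  IsSmoothForm α ∧ ∀ p v, IsPosBasis (o.at_ p) v → 0 < wedgeExtD α p v

/-- Negative contact forms: `α ∧ dα` is a negative volume form. -/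
def IsNegContactForm (o : MOrientation M) (α : OneForm M) : Prop :=
  IsSmoothForm α ∧ ∀ p v, IsPosBasis (o.at_ p) v → wedgeExtD α p v < 0

/-- The field of kernels of a 1-form. -/
def kerField (α : OneForm M) : SubspaceField M := fun p => (α p).ker

/-- Positive contact structures: kernels of positive contact forms. -/
def IsPosContactStructure (o : MOrientation M) (ξ : SubspaceField M) : Prop :=
  ∃ β, IsPosContactForm o β ∧ ξ = kerField β

/-- Negative contact structures: kernels of negative contact forms. -/
def IsNegContactStructure (o : MOrientation M) (ξ : SubspaceField M) : Prop :=
  ∃ β, IsNegContactForm o β ∧ ξ = kerField β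

/-- Bi-contact structures: transverse pairs of a negative and a positive contact structure. -/
structure IsBiContact (o : MOrientation M) (ξneg ξpos : SubspaceField M) : Prop where
  neg : IsNegContactStructure o ξneg
  pos : IsPosContactStructure o ξpos
  transverse : ∀ p, ξneg p ⊔ ξpos p = ⊤

/-- The pair `(ξneg, ξpos)` is a bi-contact structure supporting the non-vanishing vector
field `X`. -/
structure IsSupportingBiContact (o : MOrientation M) (X : VecField M)
    (ξneg ξpos : SubspaceField M) : Prop where
  biContact : IsBiContact o ξneg ξpos
  ne_zero : ∀ p, X p ≠ 0
  mem : ∀ p, X p ∈ ξneg p ⊓ ξpos p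

/-- The positive contact form `α` supports `X`: its kernel is part of a bi-contact structure
supporting `X`. -/
def IsSupportingForm (o : MOrientation M) (X : VecField M) (α : OneForm M) : Prop :=
  IsPosContactForm o α ∧ ∃ ξneg, IsSupportingBiContact o X ξneg (kerField α)

/-- `R` is the Reeb vector field of the contact form `α`. -/
structure IsReeb (α : OneForm M) (R : VecField M) : Prop where
  smooth : IsSmoothField R
  normalized : ∀ p, α p (R p) = 1
  kernel : ∀ p w, extD α p (R p) w = 0

/-- The span `⟨V, W⟩` of two vector fields. -/
def spanField (V W : VecField M) : SubspaceField M := fun p => Submodule.span ℝ {V p, W p}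

/-- `E` is a continuous oriented line field: it is spanned by a continuous non-vanishing vector
field. -/
def IsContOrientableLine (E : SubspaceField M) : Prop :=
  ∃ e : VecField M, IsContField e ∧ ∀ p, e p ≠ 0 ∧ E p = Submodule.span ℝ {e p}

/-- The Anosov condition for the flow `φ` of `X`, transversally oriented, together with its
splitting `TM = ⟨X⟩ ⊕ E^s ⊕ E^u`. The two complementarity conditions say, for line fields on a
3-manifold, that the sum of `⟨X⟩`, `E^s` and `E^u` is direct and is all of `TM`. -/
structure AnosovSplitting (X : VecField M) (φ : ℝ → M → M) where
  Es : SubspaceField M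
  Eu : SubspaceField M
  line_s : IsContOrientableLine Es
  line_u : IsContOrientableLine Eu
  compl_s : ∀ p, IsCompl (Es p) (Submodule.span ℝ {X p} ⊔ Eu p)
  compl_u : ∀ p, IsCompl (Eu p) (Submodule.span ℝ {X p} ⊔ Es p)
  invariant_s : ∀ t p,
    (Es p).map (mfderiv (𝓡 3) (𝓡 3) (φ t) p).toLinearMap = Es (φ t p)
  invariant_u : ∀ t p,
    (Eu p).map (mfderiv (𝓡 3) (𝓡 3) (φ t) p).toLinearMap = Eu (φ t p)
  hyperbolic : ∃ N : ∀ p : M, Seminorm ℝ (TangentSpace (𝓡 3) p),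
    (∀ p v, N p v = 0 → v = 0) ∧
    Continuous (fun v : TangentBundle (𝓡 3) M => N v.1 v.2) ∧
    ∃ A C : ℝ, 0 < A ∧ 0 < C ∧ ∀ p, ∀ t : ℝ, 0 ≤ t →
      (∀ e ∈ Es p, N (φ t p) (mfderiv (𝓡 3) (𝓡 3) (φ t) p e) ≤
        A * Real.exp (-C * t) * N p e) ∧
      (∀ e ∈ Eu p, A⁻¹ * Real.exp (C * t) * N p e ≤
        N (φ t p) (mfderiv (𝓡 3) (𝓡 3) (φ t) p e))

namespace AnosovSplitting

variable {X : VecField M} {φ : ℝ → M → M} (S : AnosovSplitting X φ)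

/-- The part `β_u` of a 1-form `β` with `β(X) = 0`, for the unique expression `β = β_u - β_s`
with `β_u` vanishing on `⟨X⟩ ⊕ E^s` and `β_s` vanishing on `⟨X⟩ ⊕ E^u`. -/
def unstablePart (β : OneForm M) : OneForm M := fun p =>
  (β p).comp (LinearMap.toContinuousLinearMap ((S.Eu p).projection _ (S.compl_u p)))

/-- The part `β_s` of a 1-form `β` with `β(X) = 0`, in the expression `β = β_u - β_s`. -/
def stablePart (β : OneForm M) : OneForm M := fun p =>
  -(β p).comp (LinearMap.toContinuousLinearMap ((S.Es p).projection _ (S.compl_s p)))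

/-- The norm that a 1-form `β = β_u - β_s` induces on `E^s ⊕ E^u`: it is `|β_u|` on `E^u` and
`|β_s|` on `E^s`. (It is extended by `0` to `⟨X⟩`.) -/
def inducedNorm (β : OneForm M) (p : M) : Seminorm ℝ (TangentSpace (𝓡 3) p) :=
  (S.unstablePart β p).toLinearMap.toSeminorm + (S.stablePart β p).toLinearMap.toSeminorm

/-- `N` restricts to a norm on `E^s ⊕ E^u` that is projectively adapted, i.e. `E^u` dominates
`E^s` with immediate effect. -/
def IsProjAdapted (N : ∀ p : M, Seminorm ℝ (TangentSpace (𝓡 3) p)) : Prop :=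
  (∀ p, ∀ v ∈ S.Es p ⊔ S.Eu p, N p v = 0 → v = 0) ∧
  ∃ C : ℝ, 0 < C ∧ ∀ p, ∀ t : ℝ, 0 ≤ t → ∀ es ∈ S.Es p, ∀ eu ∈ S.Eu p, eu ≠ 0 →
    N (φ t p) (mfderiv (𝓡 3) (𝓡 3) (φ t) p es) / N (φ t p) (mfderiv (𝓡 3) (𝓡 3) (φ t) p eu)
      ≤ Real.exp (-C * t) * (N p es / N p eu)

/-- The supporting contact form `α`, with Reeb field `R`, is adapted: in the coordinates
`(α_s, α_u)` of `TM / ⟨X⟩ = E^s ⊕ E^u`, the Reeb field lies in the open second or fourth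
quadrant. -/
def IsAdapted (o : MOrientation M) (α : OneForm M) (R : VecField M) : Prop :=
  IsSupportingForm o X α ∧ ∀ p, S.stablePart α p (R p) * S.unstablePart α p (R p) < 0

end AnosovSplitting

/-- The supporting contact form `α`, with Reeb field `R`, is strongly adapted to `X`. -/
def IsStronglyAdapted (o : MOrientation M) (X : VecField M) (α : OneForm M)
    (R : VecField M) : Prop :=
  IsSupportingForm o X α ∧ IsNegContactStructure o (spanField X R)

/-- `(V, W)` is a basis of `ker α` that is positive for the orientation of `ker α` for which
`dα` is a positive area form. -/
def IsCoorientedBasis (α : OneForm M) (V W : VecField M) : Prop :=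
  ∀ p, LinearIndependent ℝ ![V p, W p] ∧ spanField V W p = kerField α p ∧
    0 < extD α p (V p) (W p)

end AnosovContact

end

open AnosovContact

/-! Put β = `lieD φ α`. Since α(X) = 0, Cartan's formula gives β = dα(X, ·), so β kills X and the
Reeb field R. Moreover (α ∧ dα)(X, v, w) = α(w)β(v) − α(v)β(w), so β vanishes nowhere and its kernel
is ⟨X, R⟩.

Conditions 1, 2, 3, 5 and 6 all reduce to condition 7, the sign of β([R, X]). Indeed, if β(w) ≠ 0,
then on (X, R, w) the form α ∧ dα is −β(w), while β ∧ dβ is β(w)β([R, X]). Any other form with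
kernel ⟨X, R⟩ gives the same sign (`isNegContactForm_lieD_iff`, `isNegContactStructure_span_iff`).

Evaluating β ∧ dβ on a frame (X, e_s, e_u) of the splitting instead shows that β is a negative
contact form exactly when (L_X β)(e)/β(e) is smaller on e_s than on e_u
(`isNegContactForm_lieD_iff_rates`). As β(e) = r α(e), these quotients are r + X·ln|r|, which is
condition 8. They are also the logarithmic growth rates of the norm induced by β, so compactness of
M turns the inequality into domination, condition 4 (`isProjAdapted_inducedNorm_iff`).

The signs of the rates come from β(R) = 0: the quadrant condition forces r_s r_u < 0, and the growth
of E^u forces r_u > 0 (`rate_pos`). The fields e_s, e_u are only continuous and are never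
differentiated: derivatives are taken of pull-backs of smooth forms, evaluated on a fixed vector. -/

noncomputable section

namespace AnosovContact

/-! ### Forms, fields, exterior derivative and bracket in charts -/

section Charts

variable {M : Type*} [TopologicalSpace M] [ChartedSpace R3 M] [IsManifold (𝓡 3) ∞ M]

lemma mfderiv_chart_symm_comp {p₀ x : M} (hx : x ∈ (extChartAt (𝓡 3) p₀).source)
    (v : TangentSpace (𝓡 3) x) :
    mfderiv 𝓘(ℝ, R3) (𝓡 3) (extChartAt (𝓡 3) p₀).symm (extChartAt (𝓡 3) p₀ x)
      (mfderiv (𝓡 3) 𝓘(ℝ, R3) (extChartAt (𝓡 3) p₀) x v) = v := by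
  have : IsManifold (𝓡 3) 1 M := IsManifold.of_le (n := ∞) (by simp)
  have h := mfderivWithin_extChartAt_symm_comp_mfderiv_extChartAt' (I := 𝓡 3) hx
  rw [ModelWithCorners.range_eq_univ, mfderivWithin_univ] at h
  exact congrArg (fun L => L v) h

lemma mfderiv_chart_comp_symm {p₀ : M} {y : R3} (hy : y ∈ (extChartAt (𝓡 3) p₀).target)
    (v : R3) :
    mfderiv (𝓡 3) 𝓘(ℝ, R3) (extChartAt (𝓡 3) p₀) ((extChartAt (𝓡 3) p₀).symm y)
      (mfderiv 𝓘(ℝ, R3) (𝓡 3) (extChartAt (𝓡 3) p₀).symm y v) = v := by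
  have : IsManifold (𝓡 3) 1 M := IsManifold.of_le (n := ∞) (by simp)
  have h := mfderiv_extChartAt_comp_mfderivWithin_extChartAt_symm (I := 𝓡 3) hy
  rw [ModelWithCorners.range_eq_univ, mfderivWithin_univ] at h
  exact congrArg (fun L => L v) h

/-- The coordinate expression of the vector field `V` in the preferred chart at `p₀`. -/
def coordField (V : VecField M) (p₀ : M) (y : R3) : R3 :=
  mfderiv (𝓡 3) 𝓘(ℝ, R3) (extChartAt (𝓡 3) p₀) ((extChartAt (𝓡 3) p₀).symm y)
    (V ((extChartAt (𝓡 3) p₀).symm y))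

lemma coordForm_apply_mfderiv (γ : OneForm M) {p₀ x : M}
    (hx : x ∈ (extChartAt (𝓡 3) p₀).source) (v : TangentSpace (𝓡 3) x) :
    coordForm γ p₀ (extChartAt (𝓡 3) p₀ x)
      (mfderiv (𝓡 3) 𝓘(ℝ, R3) (extChartAt (𝓡 3) p₀) x v) = γ x v := by
  have h := mfderiv_chart_symm_comp hx v
  have e := (extChartAt (𝓡 3) p₀).left_inv hx
  unfold coordForm
  change γ ((extChartAt (𝓡 3) p₀).symm (extChartAt (𝓡 3) p₀ x))
    (mfderiv 𝓘(ℝ, R3) (𝓡 3) (extChartAt (𝓡 3) p₀).symm (extChartAt (𝓡 3) p₀ x) _) = _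
  rw [h]
  -- The base point occurs in the types of the tangent vectors, so it is generalised and substituted
  -- instead of rewritten.
  generalize (extChartAt (𝓡 3) p₀).symm (extChartAt (𝓡 3) p₀ x) = x' at e
  subst e
  rfl

lemma coordForm_apply_coordField (γ : OneForm M) (V : VecField M) {p₀ : M} {y : R3}
    (hy : y ∈ (extChartAt (𝓡 3) p₀).target) :
    coordForm γ p₀ y (coordField V p₀ y) =
      γ ((extChartAt (𝓡 3) p₀).symm y) (V ((extChartAt (𝓡 3) p₀).symm y)) := by
  have := coordForm_apply_mfderiv γ ((extChartAt (𝓡 3) p₀).map_target hy)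
    (V ((extChartAt (𝓡 3) p₀).symm y))
  rwa [(extChartAt (𝓡 3) p₀).right_inv hy] at this

lemma inCoordinates_eq_coordForm (γ : OneForm M) {p₀ x : M}
    (hx : x ∈ (extChartAt (𝓡 3) p₀).source) :
    ContinuousLinearMap.inCoordinates R3 (TangentSpace (𝓡 3)) ℝ (Bundle.Trivial M ℝ)
      p₀ x p₀ x (γ x) = coordForm γ p₀ (extChartAt (𝓡 3) p₀ x) := by
  have : IsManifold (𝓡 3) 1 M := IsManifold.of_le (n := ∞) (by simp)
  have hx' : x ∈ (chartAt R3 p₀).source := by simpa using hx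
  have h := TangentBundle.symmL_trivializationAt (I := 𝓡 3) hx'
  rw [ModelWithCorners.range_eq_univ, mfderivWithin_univ] at h
  have e := (extChartAt (𝓡 3) p₀).left_inv hx
  unfold ContinuousLinearMap.inCoordinates
  rw [h]
  unfold coordForm
  generalize mfderiv 𝓘(ℝ, R3) (𝓡 3) (extChartAt (𝓡 3) p₀).symm (extChartAt (𝓡 3) p₀ x) = D
  generalize (extChartAt (𝓡 3) p₀).symm (extChartAt (𝓡 3) p₀ x) = x' at e D
  subst e
  ext v
  simp

/-- Near p₀ the fibre part of the section, read in the trivialisation at p₀, is `coordForm γ p₀`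
composed with the chart. This links bundle smoothness with `extD`, which is defined in coordinates.
-/
lemma isSmoothForm_iff (γ : OneForm M) :
    IsSmoothForm γ ↔ ∀ p₀, ContDiffAt ℝ ∞ (coordForm γ p₀) (extChartAt (𝓡 3) p₀ p₀) := by
  refine forall_congr' fun p₀ => ?_
  rw [contMDiffAt_hom_bundle]
  have h1 : ContMDiffAt (𝓡 3) (𝓡 3) ∞ (fun x : M => x) p₀ := contMDiffAt_id
  have h2 : (fun x : M => ContinuousLinearMap.inCoordinates R3 (TangentSpace (𝓡 3)) ℝ
      (Bundle.Trivial M ℝ) p₀ x p₀ x (γ x)) =ᶠ[𝓝 p₀]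
      (fun x => coordForm γ p₀ (extChartAt (𝓡 3) p₀ x)) := by
    filter_upwards [extChartAt_source_mem_nhds (I := 𝓡 3) p₀] with x hx
    exact inCoordinates_eq_coordForm γ hx
  have h3 : ContMDiffAt (𝓡 3) 𝓘(ℝ, R3 →L[ℝ] ℝ) ∞
      (fun x => coordForm γ p₀ (extChartAt (𝓡 3) p₀ x)) p₀ ↔
      ContDiffAt ℝ ∞ (coordForm γ p₀) (extChartAt (𝓡 3) p₀ p₀) := by
    rw [← contMDiffAt_iff_contDiffAt]
    constructor
    · intro h
      have hs : ContMDiffAt 𝓘(ℝ, R3) (𝓡 3) ∞ (extChartAt (𝓡 3) p₀).symm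
          (extChartAt (𝓡 3) p₀ p₀) :=
        (contMDiffOn_extChartAt_symm p₀).contMDiffAt (extChartAt_target_mem_nhds p₀)
      have := ContMDiffAt.comp_of_eq h hs (extChartAt_to_inv p₀)
      refine this.congr_of_eventuallyEq ?_
      filter_upwards [extChartAt_target_mem_nhds (I := 𝓡 3) p₀] with y hy
      simp only [Function.comp_apply]
      rw [(extChartAt (𝓡 3) p₀).right_inv hy]
    · intro h
      exact ContMDiffAt.comp p₀ h contMDiffAt_extChartAt
  rw [← h3, ← h2.contMDiffAt_iff]
  exact and_iff_right h1

lemma mpullbackWithin_chart_symm (V : VecField M) {p₀ : M} {y : R3}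
    (hy : y ∈ (extChartAt (𝓡 3) p₀).target) :
    VectorField.mpullbackWithin 𝓘(ℝ, R3) (𝓡 3) (extChartAt (𝓡 3) p₀).symm V
      (Set.range (𝓡 3)) y = coordField V p₀ y := by
  have : IsManifold (𝓡 3) 1 M := IsManifold.of_le (n := ∞) (by simp)
  have h1 := mfderiv_extChartAt_comp_mfderivWithin_extChartAt_symm (I := 𝓡 3) hy
  have h2 := mfderivWithin_extChartAt_symm_comp_mfderiv_extChartAt (I := 𝓡 3) hy
  rw [VectorField.mpullbackWithin_apply, ContinuousLinearMap.inverse_eq h2 h1]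
  rfl

lemma IsSmoothField.contDiffAt_coordField {V : VecField M} (hV : IsSmoothField V) (p₀ : M) :
    ContDiffAt ℝ ∞ (coordField V p₀) (extChartAt (𝓡 3) p₀ p₀) := by
  have h := VectorField.contMDiffWithinAt_mpullbackWithin_extChartAt_symm (n := ∞) (m := ∞)
    (s := Set.univ) (hV p₀).contMDiffWithinAt uniqueMDiffOn_univ (Set.mem_univ p₀) (by simp)
  rw [contMDiffWithinAt_vectorSpace_iff_contDiffWithinAt] at h
  have h' := h.contDiffAt (by simpa using extChartAt_target_mem_nhds (I := 𝓡 3) p₀)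
  refine h'.congr_of_eventuallyEq ?_
  filter_upwards [extChartAt_target_mem_nhds (I := 𝓡 3) p₀] with y hy
  exact (mpullbackWithin_chart_symm V hy).symm

lemma bracket_chart {V W : VecField M} (p : M) :
    mfderiv (𝓡 3) 𝓘(ℝ, R3) (extChartAt (𝓡 3) p) p (bracket V W p) =
      fderiv ℝ (coordField W p) (extChartAt (𝓡 3) p p) (coordField V p (extChartAt (𝓡 3) p p)) -
      fderiv ℝ (coordField V p) (extChartAt (𝓡 3) p p)
        (coordField W p (extChartAt (𝓡 3) p p)) := by
  have : IsManifold (𝓡 3) 1 M := IsManifold.of_le (n := ∞) (by simp)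
  have hev (U : VecField M) : VectorField.mpullbackWithin 𝓘(ℝ, R3) (𝓡 3)
      (extChartAt (𝓡 3) p).symm U (Set.range (𝓡 3)) =ᶠ[𝓝 (extChartAt (𝓡 3) p p)]
      coordField U p := by
    filter_upwards [extChartAt_target_mem_nhds (I := 𝓡 3) p] with y hy
    exact mpullbackWithin_chart_symm U hy
  have hinv := isInvertible_mfderiv_extChartAt (I := 𝓡 3) (mem_extChartAt_source (I := 𝓡 3) p)
  have hL : VectorField.lieBracketWithin ℝ (E := R3)
      (VectorField.mpullbackWithin 𝓘(ℝ, R3) (𝓡 3)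
        (extChartAt (𝓡 3) p).symm V (Set.range (𝓡 3)))
      (VectorField.mpullbackWithin 𝓘(ℝ, R3) (𝓡 3)
        (extChartAt (𝓡 3) p).symm W (Set.range (𝓡 3)))
      ((extChartAt (𝓡 3) p).symm ⁻¹' Set.univ ∩ Set.range (𝓡 3)) (extChartAt (𝓡 3) p p) =
      VectorField.lieBracket ℝ (coordField V p) (coordField W p) (extChartAt (𝓡 3) p p) := by
    have hu : (extChartAt (𝓡 3) p).symm ⁻¹' Set.univ ∩ Set.range (𝓡 3) = Set.univ := by
      rw [Set.preimage_univ, Set.univ_inter, ModelWithCorners.range_eq_univ]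
    rw [hu]
    refine (congrFun VectorField.lieBracketWithin_univ _).trans ?_
    exact (hev V).lieBracket_vectorField_eq (hev W)
  refine (hinv.self_apply_inverse _).trans ?_
  exact hL

/-- In dγ(V, W) = V(γ(W)) − W(γ(V)) − γ([V, W]) the first two terms vanish. In coordinates, `key`
differentiates the constant γ(U) in a direction w. -/
lemma extD_of_apply_const {γ : OneForm M} {V W : VecField M} (hγ : IsSmoothForm γ)
    (hV : IsSmoothField V) (hW : IsSmoothField W) {c d : ℝ} (hc : ∀ p, γ p (V p) = c)
    (hd : ∀ p, γ p (W p) = d) (p : M) :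
    extD γ p (V p) (W p) = - γ p (bracket V W p) := by
  have key (U : VecField M) (hU : IsSmoothField U) (c : ℝ) (hc : ∀ p, γ p (U p) = c) (w : R3) :
      fderiv ℝ (coordForm γ p) (extChartAt (𝓡 3) p p) w (coordField U p (extChartAt (𝓡 3) p p))
       + coordForm γ p (extChartAt (𝓡 3) p p)
        (fderiv ℝ (coordField U p) (extChartAt (𝓡 3) p p) w) = 0 := by
    have hg := (((isSmoothForm_iff γ).1 hγ p).differentiableAt (by simp)).hasFDerivAt
    have hu := ((hU.contDiffAt_coordField p).differentiableAt (by simp)).hasFDerivAt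
    have h := hg.clm_apply hu
    have h0 : HasFDerivAt (fun y => coordForm γ p y (coordField U p y)) (0 : R3 →L[ℝ] ℝ)
        (extChartAt (𝓡 3) p p) := by
      refine (hasFDerivAt_const c _).congr_of_eventuallyEq ?_
      filter_upwards [extChartAt_target_mem_nhds (I := 𝓡 3) p] with y hy
      rw [coordForm_apply_coordField γ U hy, hc]
    rw [add_comm]
    exact congrArg (fun L => L w) (h.unique h0)
  have hs := mem_extChartAt_source (I := 𝓡 3) p
  have hval (U : VecField M) : mfderiv (𝓡 3) 𝓘(ℝ, R3) (extChartAt (𝓡 3) p) p (U p) =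
      coordField U p (extChartAt (𝓡 3) p p) := by
    unfold coordField
    rw [(extChartAt (𝓡 3) p).left_inv hs]
  rw [← coordForm_apply_mfderiv γ hs, bracket_chart]
  unfold extD
  simp only [hval]
  have h1 := key V hV c hc (coordField W p (extChartAt (𝓡 3) p p))
  have h2 := key W hW d hd (coordField V p (extChartAt (𝓡 3) p p))
  erw [map_sub]
  linarith

end Charts

/-! ### Time derivative of the pull-backs of a form by a flow -/

lemma HasDerivAt.clm_comp_const {E F G : Type*} [NormedAddCommGroup E] [NormedSpace ℝ E]
    [NormedAddCommGroup F] [NormedSpace ℝ F] [NormedAddCommGroup G] [NormedSpace ℝ G]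
    {c : ℝ → F →L[ℝ] G} {c' : F →L[ℝ] G} {t : ℝ} (h : HasDerivAt c c' t) (D : E →L[ℝ] F) :
    HasDerivAt (fun s => (c s).comp D) (c'.comp D) t := by
  simpa using h.clm_comp (hasDerivAt_const t D)

/-- The derivative at `t = 0` of the pull-backs of a 1-form by a flow, in a vector space. -/
lemma hasDerivAt_pullback_flow {E : Type*} [NormedAddCommGroup E] [NormedSpace ℝ E]
    {g : E → E →L[ℝ] ℝ} {Φ : ℝ × E → E} {Y : E → E} {y : E}
    (hg : DifferentiableAt ℝ g y) (hΦ : ContDiffAt ℝ ∞ Φ (0, y))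
    (hΦ0 : ∀ᶠ z in 𝓝 y, Φ (0, z) = z)
    (hY : ∀ᶠ z in 𝓝 y, HasDerivAt (fun t => Φ (t, z)) (Y z) 0) :
    HasDerivAt (fun t : ℝ => (g (Φ (t, y))).comp
        ((fderiv ℝ Φ (t, y)).comp (ContinuousLinearMap.inr ℝ ℝ E)))
      (fderiv ℝ g y (Y y) + (g y).comp (fderiv ℝ Y y)) 0 := by
  have h0 : Φ (0, y) = y := hΦ0.self_of_nhds
  have hA : HasDerivAt (fun t => g (Φ (t, y))) (fderiv ℝ g y (Y y)) 0 := by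
    have hg' : HasFDerivAt g (fderiv ℝ g y) (Φ (0, y)) := by rw [h0]; exact hg.hasFDerivAt
    exact hg'.comp_hasDerivAt (0 : ℝ) hY.self_of_nhds
  have hd : HasFDerivAt Φ (fderiv ℝ Φ (0, y)) (0, y) :=
    (hΦ.differentiableAt (by simp)).hasFDerivAt
  have hd2 : HasFDerivAt (fderiv ℝ Φ) (fderiv ℝ (fderiv ℝ Φ) (0, y)) (0, y) :=
    ((hΦ.fderiv_right (m := 1) (by norm_cast)).differentiableAt (by simp)).hasFDerivAt
  have hl : HasDerivAt (fun t : ℝ => (t, y)) ((1 : ℝ), (0 : E)) 0 :=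
    (hasDerivAt_id _).prodMk (hasDerivAt_const _ _)
  have hB' : HasDerivAt (fun t : ℝ => fderiv ℝ Φ (t, y))
      (fderiv ℝ (fderiv ℝ Φ) (0, y) (1, 0)) 0 := hd2.comp_hasDerivAt (0 : ℝ) hl
  have hB := HasDerivAt.clm_comp_const hB' (ContinuousLinearMap.inr ℝ ℝ E)
  have hC := hA.clm_comp hB
  have hr (z : E) : HasFDerivAt (fun z : E => ((0 : ℝ), z)) (ContinuousLinearMap.inr ℝ ℝ E) z :=
    hasFDerivAt_prodMk_right _ _
  have hid : (fderiv ℝ Φ (0, y)).comp (ContinuousLinearMap.inr ℝ ℝ E) =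
      ContinuousLinearMap.id ℝ E := by
    refine (hd.comp y (hr y)).unique ?_
    exact (hasFDerivAt_id y).congr_of_eventuallyEq hΦ0
  -- Y is the time derivative of Φ at time 0, so by symmetry of second derivatives its space
  -- derivative is the time derivative of the space derivative of Φ.
  have hYf : fderiv ℝ Y y = (fderiv ℝ (fderiv ℝ Φ) (0, y) (1, 0)).comp
      (ContinuousLinearMap.inr ℝ ℝ E) := by
    have hev : Y =ᶠ[𝓝 y] fun z => fderiv ℝ Φ (0, z) (1, 0) := by
      have hdiff : ∀ᶠ z in 𝓝 y, DifferentiableAt ℝ Φ (0, z) := by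
        have h1 : ∀ᶠ q in 𝓝 ((0 : ℝ), y), DifferentiableAt ℝ Φ q :=
          ((hΦ.of_le (m := 1) (by norm_cast)).eventually (by simp)).mono
            fun q hq => hq.differentiableAt (by simp)
        exact (Continuous.tendsto (f := fun z : E => ((0 : ℝ), z)) (by fun_prop) y).eventually h1
      filter_upwards [hY, hdiff] with z hz hz'
      have hl : HasDerivAt (fun t : ℝ => (t, z)) ((1 : ℝ), (0 : E)) 0 :=
        (hasDerivAt_id _).prodMk (hasDerivAt_const _ _)
      exact hz.unique (hz'.hasFDerivAt.comp_hasDerivAt (0 : ℝ) hl)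
    have h1 : HasFDerivAt (fun z => fderiv ℝ Φ (0, z))
        ((fderiv ℝ (fderiv ℝ Φ) (0, y)).comp (ContinuousLinearMap.inr ℝ ℝ E)) y :=
      hd2.comp y (hr y)
    have h2 := h1.clm_apply (hasFDerivAt_const ((1 : ℝ), (0 : E)) y)
    rw [hev.fderiv_eq, h2.fderiv]
    have hsymm := hΦ.isSymmSndFDerivAt (by simp; norm_cast)
    ext w
    simpa using hsymm.eq (0, w) (1, 0)
  refine hC.congr_deriv ?_
  rw [hYf]
  ext w
  have hw := congrArg (fun L => L w) hid
  simp only [ContinuousLinearMap.comp_apply, ContinuousLinearMap.id_apply,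
    ContinuousLinearMap.inr_apply] at hw
  simp [h0, hw]

lemma hasDerivAt_of_hasMFDerivAt {E : Type*} [NormedAddCommGroup E] [NormedSpace ℝ E]
    {f : ℝ → E} {L : ℝ →L[ℝ] E} {v : E} {t : ℝ} (h : HasMFDerivAt 𝓘(ℝ, ℝ) 𝓘(ℝ, E) f t L)
    (hv : L 1 = v) : HasDerivAt f v t :=
  have h' : HasFDerivAt f L t := h.hasFDerivAt
  hv ▸ h'.hasDerivAt

section Flow

variable {M : Type*} [TopologicalSpace M] [ChartedSpace R3 M]
  {X : VecField M} {φ : ℝ → M → M}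

lemma IsFlowOf.contMDiff_time (hφ : IsFlowOf X φ) (t : ℝ) : ContMDiff (𝓡 3) (𝓡 3) ∞ (φ t) :=
  hφ.smooth.comp (contMDiff_const.prodMk contMDiff_id)

lemma IsFlowOf.mdifferentiableAt (hφ : IsFlowOf X φ) (t : ℝ) (p : M) :
    MDifferentiableAt (𝓡 3) (𝓡 3) (φ t) p :=
  (hφ.contMDiff_time t p).mdifferentiableAt (by simp)

variable [IsManifold (𝓡 3) ∞ M]

/-- The flow `φ` in the preferred chart at `p₀`. -/
def coordFlow (φ : ℝ → M → M) (p₀ : M) (q : ℝ × R3) : R3 :=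
  extChartAt (𝓡 3) p₀ (φ q.1 ((extChartAt (𝓡 3) p₀).symm q.2))

lemma IsFlowOf.contDiffAt_coordFlow (hφ : IsFlowOf X φ) {p₀ : M} {t : ℝ} {y : R3}
    (hy : y ∈ (extChartAt (𝓡 3) p₀).target)
    (ht : φ t ((extChartAt (𝓡 3) p₀).symm y) ∈ (extChartAt (𝓡 3) p₀).source) :
    ContDiffAt ℝ ∞ (coordFlow φ p₀) (t, y) := by
  rw [← contMDiffAt_iff_contDiffAt]
  have h1 : ContMDiffAt 𝓘(ℝ, ℝ × R3) 𝓘(ℝ, ℝ) ∞ (fun q : ℝ × R3 => q.1) (t, y) :=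
    contDiffAt_fst.contMDiffAt
  have h2 : ContMDiffAt 𝓘(ℝ, ℝ × R3) 𝓘(ℝ, R3) ∞ (fun q : ℝ × R3 => q.2) (t, y) :=
    contDiffAt_snd.contMDiffAt
  have hs : ContMDiffAt 𝓘(ℝ, R3) (𝓡 3) ∞ (extChartAt (𝓡 3) p₀).symm y :=
    (contMDiffOn_extChartAt_symm p₀).contMDiffAt
      ((isOpen_extChartAt_target p₀).mem_nhds hy)
  have h3 := ContMDiffAt.comp_of_eq (x := (t, y)) hs h2 rfl
  have h4 := ContMDiffAt.comp_of_eq (x := (t, y)) (hφ.smooth.contMDiffAt) (h1.prodMk h3) rfl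
  exact ContMDiffAt.comp_of_eq (x := (t, y))
    (contMDiffAt_extChartAt' (by simpa using ht)) h4 rfl

lemma IsFlowOf.hasDerivAt_coordFlow (hφ : IsFlowOf X φ) {p₀ : M} {y : R3}
    (hy : y ∈ (extChartAt (𝓡 3) p₀).target) :
    HasDerivAt (fun t => coordFlow φ p₀ (t, y)) (coordField X p₀ y) 0 := by
  have : IsManifold (𝓡 3) 1 M := IsManifold.of_le (n := ∞) (by simp)
  have hv := hφ.velocity ((extChartAt (𝓡 3) p₀).symm y) 0
  have hs := (extChartAt (𝓡 3) p₀).map_target hy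
  have hc : MDifferentiableAt (𝓡 3) 𝓘(ℝ, R3) (extChartAt (𝓡 3) p₀)
      (φ 0 ((extChartAt (𝓡 3) p₀).symm y)) := by
    rw [hφ.zero]
    exact mdifferentiableAt_extChartAt (by simpa using hs)
  refine hasDerivAt_of_hasMFDerivAt (hc.hasMFDerivAt.comp (0 : ℝ) hv) ?_
  have e : φ 0 ((extChartAt (𝓡 3) p₀).symm y) = (extChartAt (𝓡 3) p₀).symm y := hφ.zero _
  unfold coordField
  refine Eq.trans (b := mfderiv (𝓡 3) 𝓘(ℝ, R3) (extChartAt (𝓡 3) p₀)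
    (φ 0 ((extChartAt (𝓡 3) p₀).symm y)) ((1 : ℝ) • X (φ 0 ((extChartAt (𝓡 3) p₀).symm y)))) rfl ?_
  rw [one_smul, e]

lemma IsFlowOf.mfderiv_chart_comp (hφ : IsFlowOf X φ) {p₀ x : M} {t : ℝ}
    (hx : x ∈ (extChartAt (𝓡 3) p₀).source)
    (ht : φ t x ∈ (extChartAt (𝓡 3) p₀).source) (v : TangentSpace (𝓡 3) x) :
    mfderiv (𝓡 3) 𝓘(ℝ, R3) (extChartAt (𝓡 3) p₀) (φ t x) (mfderiv (𝓡 3) (𝓡 3) (φ t) x v) =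
      fderiv ℝ (coordFlow φ p₀) (t, extChartAt (𝓡 3) p₀ x)
        (0, mfderiv (𝓡 3) 𝓘(ℝ, R3) (extChartAt (𝓡 3) p₀) x v) := by
  have : IsManifold (𝓡 3) 1 M := IsManifold.of_le (n := ∞) (by simp)
  have hc : MDifferentiableAt (𝓡 3) 𝓘(ℝ, R3) (extChartAt (𝓡 3) p₀) (φ t x) :=
    mdifferentiableAt_extChartAt (by simpa using ht)
  have hcx : MDifferentiableAt (𝓡 3) 𝓘(ℝ, R3) (extChartAt (𝓡 3) p₀) x :=
    mdifferentiableAt_extChartAt (by simpa using hx)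
  have h1 := hc.hasMFDerivAt.comp x (hφ.mdifferentiableAt t x).hasMFDerivAt
  have hF := ((hφ.contDiffAt_coordFlow (t := t) ((extChartAt (𝓡 3) p₀).map_source hx)
    (by rwa [(extChartAt (𝓡 3) p₀).left_inv hx])).differentiableAt (by simp)).hasFDerivAt
  have hF' : HasFDerivAt (fun z => coordFlow φ p₀ (t, z)) _ (extChartAt (𝓡 3) p₀ x) :=
    hF.comp (extChartAt (𝓡 3) p₀ x) (hasFDerivAt_prodMk_right t _)
  have h2 := hF'.hasMFDerivAt.comp x hcx.hasMFDerivAt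
  have h3 := h2.congr_of_eventuallyEq (f₁ := extChartAt (𝓡 3) p₀ ∘ φ t) (by
    filter_upwards [(isOpen_extChartAt_source (I := 𝓡 3) p₀).mem_nhds hx] with z hz
    simp only [Function.comp_apply, coordFlow]
    rw [(extChartAt (𝓡 3) p₀).left_inv hz])
  exact congrArg (fun L => L v) (hasMFDerivAt_unique h1 h3)

/-- Cartan's formula for the flow derivative of a 1-form, in an arbitrary preferred chart. -/
lemma IsFlowOf.hasDerivAt_pullback_chart (hφ : IsFlowOf X φ) {γ : OneForm M} {p₀ x : M}
    (hx : x ∈ (extChartAt (𝓡 3) p₀).source)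
    (hγ : DifferentiableAt ℝ (coordForm γ p₀) (extChartAt (𝓡 3) p₀ x)) :
    HasDerivAt (fun t : ℝ => pullback (φ t) γ x)
      ((fderiv ℝ (coordForm γ p₀) (extChartAt (𝓡 3) p₀ x)
          (coordField X p₀ (extChartAt (𝓡 3) p₀ x)) +
        (coordForm γ p₀ (extChartAt (𝓡 3) p₀ x)).comp
          (fderiv ℝ (coordField X p₀) (extChartAt (𝓡 3) p₀ x))).comp
        (mfderiv (𝓡 3) 𝓘(ℝ, R3) (extChartAt (𝓡 3) p₀) x)) 0 := by
  have hy := (extChartAt (𝓡 3) p₀).map_source hx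
  have e := (extChartAt (𝓡 3) p₀).left_inv hx
  have hy' := (isOpen_extChartAt_target (I := 𝓡 3) p₀).mem_nhds hy
  have h := hasDerivAt_pullback_flow (Φ := coordFlow φ p₀) (Y := coordField X p₀) hγ
    (hφ.contDiffAt_coordFlow hy (by rwa [hφ.zero, e]))
    (by filter_upwards [hy'] with z hz
        simp only [coordFlow, hφ.zero]
        exact (extChartAt (𝓡 3) p₀).right_inv hz)
    (by filter_upwards [hy'] with z hz
        exact hφ.hasDerivAt_coordFlow hz)
  -- The coordinate expression of the pull-back is valid only while the orbit stays in the chart,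
  -- which holds for small t.
  have hcont : ∀ᶠ t in 𝓝 (0 : ℝ), φ t x ∈ (extChartAt (𝓡 3) p₀).source := by
    have hc : ContinuousAt (fun t => φ t x) 0 := (hφ.velocity x 0).continuousAt
    exact hc.eventually_mem ((isOpen_extChartAt_source (I := 𝓡 3) p₀).mem_nhds
      (by rwa [hφ.zero]))
  have h' := HasDerivAt.clm_comp_const h (E := R3)
    (mfderiv (𝓡 3) 𝓘(ℝ, R3) (extChartAt (𝓡 3) p₀) x)
  refine HasDerivAt.congr_of_eventuallyEq (F := R3 →L[ℝ] ℝ) h' ?_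
  · filter_upwards [hcont] with t ht
    refine ContinuousLinearMap.ext fun v => ?_
    have h1 := hφ.mfderiv_chart_comp hx ht v
    have h2 := coordForm_apply_mfderiv γ ht (mfderiv (𝓡 3) (𝓡 3) (φ t) x v)
    rw [h1] at h2
    unfold coordFlow
    refine h2.symm.trans ?_
    simp only [e]
    rfl

end Flow

lemma HasDerivAt.clm_apply_const {E F : Type*} [NormedAddCommGroup E] [NormedSpace ℝ E]
    [NormedAddCommGroup F] [NormedSpace ℝ F]
    {c : ℝ → E →L[ℝ] F} {c' : E →L[ℝ] F} {t : ℝ} (h : HasDerivAt c c' t) (v : E) :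
    HasDerivAt (fun s => c s v) (c' v) t := by
  simpa using h.clm_apply (hasDerivAt_const t v)

/-! ### Lie derivatives and Cartan's formula -/

section LieDerivative

variable {M : Type*} [TopologicalSpace M] [ChartedSpace R3 M]
  {X : VecField M} {φ : ℝ → M → M}

lemma hasDerivAt_oneForm_apply {p : M} {f : ℝ → TangentSpace (𝓡 3) p →L[ℝ] ℝ}
    {f' : TangentSpace (𝓡 3) p →L[ℝ] ℝ} {t : ℝ} (h : HasDerivAt f f' t)
    (v : TangentSpace (𝓡 3) p) : HasDerivAt (fun s => f s v) (f' v) t :=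
  HasDerivAt.clm_apply_const (E := R3) (F := ℝ) h v

lemma extD_self (γ : OneForm M) (p : M) (v : TangentSpace (𝓡 3) p) : extD γ p v v = 0 :=
  sub_self _

lemma extD_swap (γ : OneForm M) (p : M) (v w : TangentSpace (𝓡 3) p) :
    extD γ p v w = - extD γ p w v :=
  (neg_sub _ _).symm

/-- Differentiate φ_t ∘ φ_s = φ_s ∘ φ_t in s at s = 0. -/
lemma IsFlowOf.mfderiv_apply_velocity (hφ : IsFlowOf X φ) (t : ℝ) (p : M) :
    mfderiv (𝓡 3) (𝓡 3) (φ t) p (X p) = X (φ t p) := by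
  have h0 := hφ.velocity p 0
  have ht := hφ.velocity (φ t p) 0
  have hd : HasMFDerivAt (𝓡 3) (𝓡 3) (φ t) (φ 0 p) (mfderiv (𝓡 3) (𝓡 3) (φ t) (φ 0 p)) :=
    (hφ.mdifferentiableAt t _).hasMFDerivAt
  have hc := hd.comp (0 : ℝ) h0
  have e : φ t ∘ (fun s => φ s p) = fun s => φ s (φ t p) := by
    funext s
    simp only [Function.comp_apply, ← hφ.add, add_comm]
  rw [e] at hc
  have h := congrArg (fun L : ℝ →L[ℝ] R3 => L 1) (hasMFDerivAt_unique hc ht)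
  have h' : mfderiv (𝓡 3) (𝓡 3) (φ t) (φ 0 p) ((1 : ℝ) • X (φ 0 p)) =
    (1 : ℝ) • X (φ 0 (φ t p)) := h
  rw [one_smul, one_smul, hφ.zero (φ t p), hφ.zero p] at h'
  exact h'

lemma IsFlowOf.mfderiv_add (hφ : IsFlowOf X φ) (s t : ℝ) (p : M) (v : TangentSpace (𝓡 3) p) :
    mfderiv (𝓡 3) (𝓡 3) (φ (s + t)) p v =
      mfderiv (𝓡 3) (𝓡 3) (φ s) (φ t p) (mfderiv (𝓡 3) (𝓡 3) (φ t) p v) := by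
  have e : φ (s + t) = φ s ∘ φ t := funext fun p => hφ.add s t p
  rw [e, mfderiv_comp p (hφ.mdifferentiableAt s _) (hφ.mdifferentiableAt t p)]
  rfl

lemma IsFlowOf.pullback_zero (hφ : IsFlowOf X φ) (γ : OneForm M) (p : M) :
    pullback (φ 0) γ p = γ p := by
  have e : φ 0 = id := funext hφ.zero
  unfold pullback
  rw [e, mfderiv_id]
  rfl

lemma IsFlowOf.pullback_add (hφ : IsFlowOf X φ) (γ : OneForm M) (s t : ℝ) (p : M)
    (v : TangentSpace (𝓡 3) p) :
    pullback (φ (s + t)) γ p v =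
      pullback (φ s) γ (φ t p) (mfderiv (𝓡 3) (𝓡 3) (φ t) p v) := by
  change γ (φ (s + t) p) (mfderiv (𝓡 3) (𝓡 3) (φ (s + t)) p v) = γ (φ s (φ t p)) _
  rw [hφ.mfderiv_add, hφ.add]
  rfl

variable [IsManifold (𝓡 3) ∞ M]

lemma IsFlowOf.hasDerivAt_pullback_zero (hφ : IsFlowOf X φ) {γ : OneForm M}
    (hγ : IsSmoothForm γ) (p : M) :
    HasDerivAt (fun t : ℝ => pullback (φ t) γ p) (lieD φ γ p) 0 := by
  have h := hφ.hasDerivAt_pullback_chart (mem_extChartAt_source p)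
    (((isSmoothForm_iff γ).1 hγ p).differentiableAt (by simp))
  have h' : lieD φ γ p = _ := HasDerivAt.deriv (F := R3 →L[ℝ] ℝ) h
  rw [h']
  exact h

/-- The flow derivative of the pull-backs of a 1-form, at an arbitrary time. -/
lemma IsFlowOf.hasDerivAt_pullback (hφ : IsFlowOf X φ) {γ : OneForm M}
    (hγ : IsSmoothForm γ) (p : M) (v : TangentSpace (𝓡 3) p) (t : ℝ) :
    HasDerivAt (fun s : ℝ => pullback (φ s) γ p v) (pullback (φ t) (lieD φ γ) p v) t := by
  have h := hasDerivAt_oneForm_apply (hφ.hasDerivAt_pullback_zero hγ (φ t p))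
    (mfderiv (𝓡 3) (𝓡 3) (φ t) p v)
  -- The group law moves time t at p to time 0 at φ_t p; the time is written t − t so that the shift
  -- by t can be undone.
  have h' : HasDerivAt (fun s : ℝ => pullback (φ s) γ (φ t p) (mfderiv (𝓡 3) (𝓡 3) (φ t) p v))
      (pullback (φ t) (lieD φ γ) p v) (t - t) := by rw [sub_self]; exact h
  have h2 := h'.comp_sub_const t t
  refine h2.congr_of_eventuallyEq (Filter.Eventually.of_forall fun s => ?_)
  simp only [← hφ.pullback_add, sub_add_cancel]

/-- Cartan's formula for 1-forms that vanish on `X`. -/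
lemma IsFlowOf.lieD_apply (hφ : IsFlowOf X φ) (hX : IsSmoothField X) {γ : OneForm M}
    (hγ : IsSmoothForm γ) (h0 : ∀ p, γ p (X p) = 0) (p : M) (v : TangentSpace (𝓡 3) p) :
    lieD φ γ p v = extD γ p (X p) v := by
  have hs := mem_extChartAt_source (I := 𝓡 3) p
  have hg := ((isSmoothForm_iff γ).1 hγ p).differentiableAt (by simp)
  have h := hφ.hasDerivAt_pullback_chart hs hg
  have h' : lieD φ γ p = _ := HasDerivAt.deriv (F := R3 →L[ℝ] ℝ) h
  have hu := (hX.contDiffAt_coordField p).differentiableAt (by simp)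
  have h1 := hg.hasFDerivAt.clm_apply hu.hasFDerivAt
  have h2 : HasFDerivAt (fun y => coordForm γ p y (coordField X p y)) (0 : R3 →L[ℝ] ℝ)
      (extChartAt (𝓡 3) p p) := by
    refine (hasFDerivAt_const (0 : ℝ) _).congr_of_eventuallyEq ?_
    filter_upwards [extChartAt_target_mem_nhds (I := 𝓡 3) p] with y hy
    rw [coordForm_apply_coordField γ X hy, h0]
  have hval : mfderiv (𝓡 3) 𝓘(ℝ, R3) (extChartAt (𝓡 3) p) p (X p) =
      coordField X p (extChartAt (𝓡 3) p p) := by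
    unfold coordField
    rw [(extChartAt (𝓡 3) p).left_inv hs]
  rw [h']
  unfold extD
  simp only [hval]
  set w : R3 := mfderiv (𝓡 3) 𝓘(ℝ, R3) (extChartAt (𝓡 3) p) p v with hw
  -- Differentiating γ(X) = 0 along w trades γ(D_w X) for −(D_w γ)(X), the second term of dγ(X, v).
  have h3 : coordForm γ p (extChartAt (𝓡 3) p p)
      (fderiv ℝ (coordField X p) (extChartAt (𝓡 3) p p) w) +
      fderiv ℝ (coordForm γ p) (extChartAt (𝓡 3) p p) w
        (coordField X p (extChartAt (𝓡 3) p p)) = 0 := congrArg (fun L => L w) (h1.unique h2)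
  refine Eq.trans (b := fderiv ℝ (coordForm γ p) (extChartAt (𝓡 3) p p)
      (coordField X p (extChartAt (𝓡 3) p p)) w + coordForm γ p (extChartAt (𝓡 3) p p)
      (fderiv ℝ (coordField X p) (extChartAt (𝓡 3) p p) w)) rfl ?_
  linarith

/-- Near p₀ the single chart at p₀ expresses the Lie derivative as Dγ(X) + γ ∘ DX, which is smooth.
This is why the derivative formula is needed away from the centre of the chart. -/
lemma IsFlowOf.isSmoothForm_lieD (hφ : IsFlowOf X φ) (hX : IsSmoothField X) {γ : OneForm M}
    (hγ : IsSmoothForm γ) : IsSmoothForm (lieD φ γ) := by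
  rw [isSmoothForm_iff] at hγ ⊢
  intro p₀
  have hg := hγ p₀
  have hu := hX.contDiffAt_coordField p₀
  have hs : ContDiffAt ℝ ∞ (fun y => fderiv ℝ (coordForm γ p₀) y (coordField X p₀ y) +
      (coordForm γ p₀ y).comp (fderiv ℝ (coordField X p₀) y)) (extChartAt (𝓡 3) p₀ p₀) :=
    ((hg.fderiv_right (m := ∞) (by simp)).clm_apply hu).add
      (hg.clm_comp (hu.fderiv_right (m := ∞) (by simp)))
  refine hs.congr_of_eventuallyEq ?_
  have hd : ∀ᶠ y in 𝓝 (extChartAt (𝓡 3) p₀ p₀), DifferentiableAt ℝ (coordForm γ p₀) y :=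
    ((hg.of_le (m := 1) (by norm_cast)).eventually (by simp)).mono
      fun q hq => hq.differentiableAt (by simp)
  filter_upwards [extChartAt_target_mem_nhds (I := 𝓡 3) p₀, hd] with y hy hdy
  have hr := (extChartAt (𝓡 3) p₀).right_inv hy
  have h := hφ.hasDerivAt_pullback_chart ((extChartAt (𝓡 3) p₀).map_target hy)
    (γ := γ) (by rwa [hr])
  have h' : lieD φ γ ((extChartAt (𝓡 3) p₀).symm y) = _ := HasDerivAt.deriv (F := R3 →L[ℝ] ℝ) h
  rw [hr] at h'
  unfold coordForm
  rw [h']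
  refine ContinuousLinearMap.ext fun v => ?_
  exact congrArg (fderiv ℝ (coordForm γ p₀) y (coordField X p₀ y) +
    (coordForm γ p₀ y).comp (fderiv ℝ (coordField X p₀) y)) (mfderiv_chart_comp_symm hy v)

end LieDerivative

/-! ### The 3-form γ ∧ dγ and orientations -/

section Wedge

variable {M : Type*} [TopologicalSpace M] [ChartedSpace R3 M]

lemma extD_add_left (γ : OneForm M) (p : M) (u v w : TangentSpace (𝓡 3) p) :
    extD γ p (u + v) w = extD γ p u w + extD γ p v w := by
  have h (D : R3 →L[ℝ] R3 →L[ℝ] ℝ) (a b c : R3) :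
      D (a + b) c - D c (a + b) = (D a c - D c a) + (D b c - D c b) := by
    simp only [map_add, add_apply]
    ring
  unfold extD
  simp only [map_add]
  exact h _ _ _ _

lemma extD_smul_left (γ : OneForm M) (p : M) (a : ℝ) (v w : TangentSpace (𝓡 3) p) :
    extD γ p (a • v) w = a * extD γ p v w := by
  have h (D : R3 →L[ℝ] R3 →L[ℝ] ℝ) (b c : R3) :
      D (a • b) c - D c (a • b) = a * (D b c - D c b) := by
    simp only [map_smul, smul_apply, smul_eq_mul]
    ring
  unfold extD
  simp only [map_smul]
  exact h _ _ _

lemma extD_add_right (γ : OneForm M) (p : M) (u v w : TangentSpace (𝓡 3) p) :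
    extD γ p w (u + v) = extD γ p w u + extD γ p w v := by
  rw [extD_swap, extD_add_left, extD_swap γ p w u, extD_swap γ p w v]
  ring

lemma extD_smul_right (γ : OneForm M) (p : M) (a : ℝ) (v w : TangentSpace (𝓡 3) p) :
    extD γ p w (a • v) = a * extD γ p w v := by
  rw [extD_swap, extD_smul_left, extD_swap γ p w v]
  ring

/-- `γ ∧ dγ` as an alternating map. -/
def wedgeAlt (γ : OneForm M) (p : M) : (TangentSpace (𝓡 3) p) [⋀^Fin 3]→ₗ[ℝ] ℝ where
  toFun := wedgeExtD γ p
  map_update_add' := by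
    intro inst m i x y
    obtain rfl : inst = instDecidableEqFin 3 := Subsingleton.elim _ _
    fin_cases i <;>
      simp [wedgeExtD, Function.update, extD_add_left, extD_add_right] <;> ring
  map_update_smul' := by
    intro inst m i a x
    obtain rfl : inst = instDecidableEqFin 3 := Subsingleton.elim _ _
    fin_cases i <;>
      simp [wedgeExtD, Function.update, extD_smul_left, extD_smul_right] <;> ring
  map_eq_zero_of_eq' := by
    intro v i j hij hne
    have h01 := extD_swap γ p (v 0) (v 1)
    have h12 := extD_swap γ p (v 1) (v 2)
    have h20 := extD_swap γ p (v 2) (v 0)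
    unfold wedgeExtD
    fin_cases i <;> fin_cases j <;> simp at hij hne <;>
      simp only [hij, extD_self] at * <;> rw [extD_swap γ p] <;> ring

/-- Alternating 3-forms in dimension 3 are multiples of a determinant, so signs need testing on a
single basis only. -/
lemma wedgeExtD_eq_mul_det (γ : OneForm M) {p : M}
    (b : Module.Basis (Fin 3) ℝ (TangentSpace (𝓡 3) p)) (v : Fin 3 → TangentSpace (𝓡 3) p) :
    wedgeExtD γ p v = wedgeExtD γ p b * b.det v :=
  congrArg (fun f => f v) ((wedgeAlt γ p).eq_smul_basis_det b)

lemma isPosBasis_iff_det_pos {p : M} (b : Module.Basis (Fin 3) ℝ (TangentSpace (𝓡 3) p))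
    (v : Fin 3 → TangentSpace (𝓡 3) p) : IsPosBasis b.orientation v ↔ 0 < b.det v := by
  constructor
  · rintro ⟨b', rfl, h⟩
    exact (b.orientation_eq_iff_det_pos b').1 h.symm
  · intro h
    have hv := (b.is_basis_iff_det (v := v)).2 h.ne'.isUnit
    refine ⟨Module.Basis.mk hv.1 hv.2.ge, Module.Basis.coe_mk _ _, ?_⟩
    refine ((b.orientation_eq_iff_det_pos _).2 ?_).symm
    rwa [Module.Basis.coe_mk]

lemma finrank_tangentSpace (p : M) : Module.finrank ℝ (TangentSpace (𝓡 3) p) = 3 :=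
  (finrank_euclideanSpace_fin (𝕜 := ℝ) (n := 3) :)

lemma exists_basis_orientation_eq {p : M} (o : Orientation ℝ (TangentSpace (𝓡 3) p) (Fin 3)) :
    ∃ b : Module.Basis (Fin 3) ℝ (TangentSpace (𝓡 3) p), b.orientation = o :=
  ⟨o.someBasis (by simp [finrank_tangentSpace]), o.someBasis_orientation _⟩

lemma linearIndependent_of_wedgeExtD_ne_zero {γ : OneForm M} {p : M}
    {v : Fin 3 → TangentSpace (𝓡 3) p} (hv : wedgeExtD γ p v ≠ 0) : LinearIndependent ℝ v := by
  by_contra h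
  exact hv ((wedgeAlt γ p).map_linearDependent v h)

variable [IsManifold (𝓡 3) ∞ M] {o : MOrientation M} {α : OneForm M}

lemma IsPosContactForm.isPosBasis_iff (hα : IsPosContactForm o α) (p : M)
    (v : Fin 3 → TangentSpace (𝓡 3) p) :
    IsPosBasis (o.at_ p) v ↔ 0 < wedgeExtD α p v := by
  obtain ⟨b, hb⟩ := exists_basis_orientation_eq (o.at_ p)
  have h := hα.2 p b ⟨b, rfl, hb⟩
  rw [← hb, isPosBasis_iff_det_pos, wedgeExtD_eq_mul_det α b, mul_pos_iff_of_pos_left h]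

lemma IsPosContactForm.wedgeExtD_ne_zero (hα : IsPosContactForm o α) {p : M}
    {v : Fin 3 → TangentSpace (𝓡 3) p} (hv : LinearIndependent ℝ v) : wedgeExtD α p v ≠ 0 := by
  obtain ⟨b, hb⟩ := exists_basis_orientation_eq (o.at_ p)
  have h := hα.2 p b ⟨b, rfl, hb⟩
  rw [wedgeExtD_eq_mul_det α b]
  refine mul_ne_zero h.ne' (b.is_basis_iff_det.1 ⟨hv, ?_⟩).ne_zero
  exact hv.span_eq_top_of_card_eq_finrank' (by simp [finrank_tangentSpace])

/-- The sign of `γ ∧ dγ` may be compared with that of the volume form `α ∧ dα` on any one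
basis. -/
lemma IsPosContactForm.isNegContactForm_iff (hα : IsPosContactForm o α) {γ : OneForm M}
    (hγ : IsSmoothForm γ) (v : ∀ p, Fin 3 → TangentSpace (𝓡 3) p)
    (hv : ∀ p, wedgeExtD α p (v p) ≠ 0) :
    IsNegContactForm o γ ↔ ∀ p, wedgeExtD γ p (v p) * wedgeExtD α p (v p) < 0 := by
  have hli p := linearIndependent_of_wedgeExtD_ne_zero (hv p)
  have key p : (∀ w, IsPosBasis (o.at_ p) w → wedgeExtD γ p w < 0) ↔
      wedgeExtD γ p (v p) * wedgeExtD α p (v p) < 0 := by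
    obtain ⟨b, hb⟩ := exists_basis_orientation_eq (o.at_ p)
    have hb' : IsPosBasis (o.at_ p) b := ⟨b, rfl, hb⟩
    have h := hα.2 p b hb'
    have hd : b.det (v p) ≠ 0 := fun h0 => hv p (by rw [wedgeExtD_eq_mul_det α b, h0, mul_zero])
    have hd2 : 0 < b.det (v p) ^ 2 := by positivity
    rw [wedgeExtD_eq_mul_det γ b (v p), wedgeExtD_eq_mul_det α b (v p)]
    -- Both values carry the factor det(v), which enters squared; hence v may have either
    -- orientation.
    have e : wedgeExtD γ p b * b.det (v p) * (wedgeExtD α p b * b.det (v p)) =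
      wedgeExtD γ p b * (wedgeExtD α p b * b.det (v p) ^ 2) := by ring
    have hc : 0 < wedgeExtD α p b * b.det (v p) ^ 2 := by positivity
    rw [e]
    constructor
    · intro hw
      exact mul_neg_of_neg_of_pos (hw b hb') hc
    · intro hneg' w hw
      have hneg : wedgeExtD γ p b < 0 := neg_of_mul_neg_left hneg' hc.le
      rw [← hb, isPosBasis_iff_det_pos] at hw
      rw [wedgeExtD_eq_mul_det γ b]
      exact mul_neg_of_neg_of_pos hneg hw
  exact ⟨fun h p => (key p).1 (h.2 p), fun h => ⟨hγ, fun p => (key p).2 (h p)⟩⟩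

end Wedge

section Continuity

variable {M : Type*} [TopologicalSpace M] [ChartedSpace R3 M] [IsManifold (𝓡 3) ∞ M]

/-- Used for the compactness arguments, where the fields spanning E^s and E^u are merely continuous.
-/
lemma IsSmoothForm.continuous_apply {γ : OneForm M} (hγ : IsSmoothForm γ) {e : VecField M}
    (he : IsContField e) : Continuous fun p => γ p (e p) := by
  have h1 : ContMDiff (𝓡 3) ((𝓡 3).prod 𝓘(ℝ, R3 →L[ℝ] ℝ)) 0
    (fun p => (⟨p, γ p⟩ : Bundle.TotalSpace (R3 →L[ℝ] ℝ)
      (fun x : M => TangentSpace (𝓡 3) x →L[ℝ] Bundle.Trivial M ℝ x))) :=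
    ContMDiff.of_le hγ (by simp)
  have h2 : ContMDiff (𝓡 3) (𝓡 3).tangent 0
      (fun p => (⟨p, e p⟩ : TangentBundle (𝓡 3) M)) := contMDiff_zero_iff.2 he
  have h3 := (ContMDiff.clm_bundle_apply (b := fun p : M => p) h1 h2).continuous
  exact ((Bundle.Trivial.homeomorphProd M ℝ).continuous.comp h3).snd

end Continuity

/-! ### The invariant splitting and the two parts of a form -/

section Splitting

variable {M : Type*} [TopologicalSpace M] [ChartedSpace R3 M]

/-- The vector field `e` spans the line field `E`. -/
def Generates (e : VecField M) (E : SubspaceField M) : Prop :=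
  ∀ p, e p ≠ 0 ∧ E p = Submodule.span ℝ {e p}

lemma Generates.mem {e : VecField M} {E : SubspaceField M} (h : Generates e E) (p : M) :
    e p ∈ E p := by
  rw [(h p).2]
  exact Submodule.mem_span_singleton_self _

lemma Generates.exists_smul {e : VecField M} {E : SubspaceField M} (h : Generates e E) {p : M}
    {v : TangentSpace (𝓡 3) p} (hv : v ∈ E p) : ∃ c : ℝ, v = c • e p := by
  rw [(h p).2, Submodule.mem_span_singleton] at hv
  exact hv.imp fun _ => Eq.symm

/-- The flow maps the generator of an invariant line field to a non-zero multiple of itself. -/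
lemma Generates.exists_mfderiv_eq_smul {e : VecField M} {E : SubspaceField M} {φ : ℝ → M → M}
    (h : Generates e E) (hinv : ∀ t p,
      (E p).map (mfderiv (𝓡 3) (𝓡 3) (φ t) p).toLinearMap = E (φ t p)) (t : ℝ) (p : M) :
    ∃ c : ℝ, c ≠ 0 ∧ mfderiv (𝓡 3) (𝓡 3) (φ t) p (e p) = c • e (φ t p) := by
  have h1 : mfderiv (𝓡 3) (𝓡 3) (φ t) p (e p) ∈ E (φ t p) := by
    rw [← hinv]
    exact Submodule.mem_map_of_mem (h.mem p)
  obtain ⟨c, hc⟩ := h.exists_smul h1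
  refine ⟨c, ?_, hc⟩
  -- If c were 0, the image of E p would be zero, but it is E (φ t p), which contains a non-zero
  -- vector.
  rintro rfl
  have h2 := h.mem (φ t p)
  rw [← hinv] at h2
  obtain ⟨v, hv, hv'⟩ := h2
  obtain ⟨d, rfl⟩ := h.exists_smul hv
  apply (h (φ t p)).1
  rw [← hv']
  refine (map_smul (mfderiv (𝓡 3) (𝓡 3) (φ t) p) d (e p)).trans ?_
  rw [hc, zero_smul, smul_zero]

variable [IsManifold (𝓡 3) ∞ M]

namespace AnosovSplitting

variable {X : VecField M} {φ : ℝ → M → M} (S : AnosovSplitting X φ)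

lemma unstablePart_apply_of_mem (γ : OneForm M) {p : M} {v : TangentSpace (𝓡 3) p}
    (hv : v ∈ S.Eu p) : S.unstablePart γ p v = γ p v :=
  congrArg (γ p) (Submodule.projection_apply_of_mem_left (S.compl_u p) hv)

lemma unstablePart_apply_eq_zero (γ : OneForm M) {p : M} {v : TangentSpace (𝓡 3) p}
    (hv : v ∈ Submodule.span ℝ {X p} ⊔ S.Es p) : S.unstablePart γ p v = 0 :=
  (congrArg (γ p) ((Submodule.projection_apply_eq_zero_iff (S.compl_u p)).2 hv)).trans
    (map_zero _)

lemma stablePart_apply_of_mem (γ : OneForm M) {p : M} {v : TangentSpace (𝓡 3) p}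
    (hv : v ∈ S.Es p) : S.stablePart γ p v = - γ p v :=
  congrArg (fun w => - γ p w) (Submodule.projection_apply_of_mem_left (S.compl_s p) hv)

lemma stablePart_apply_eq_zero (γ : OneForm M) {p : M} {v : TangentSpace (𝓡 3) p}
    (hv : v ∈ Submodule.span ℝ {X p} ⊔ S.Eu p) : S.stablePart γ p v = 0 :=
  (congrArg (fun w => - γ p w)
    ((Submodule.projection_apply_eq_zero_iff (S.compl_s p)).2 hv)).trans (by simp)

variable {es eu : VecField M}

lemma exists_decomp (hs : Generates es S.Es) (hu : Generates eu S.Eu) (p : M)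
    (v : TangentSpace (𝓡 3) p) : ∃ a b c : ℝ, v = a • X p + b • es p + c • eu p := by
  have hv : v ∈ S.Es p ⊔ (Submodule.span ℝ {X p} ⊔ S.Eu p) := by
    rw [(S.compl_s p).sup_eq_top]
    trivial
  obtain ⟨v1, h1, w, hw, rfl⟩ := Submodule.mem_sup.1 hv
  obtain ⟨v2, h2, v3, h3, rfl⟩ := Submodule.mem_sup.1 hw
  obtain ⟨a, rfl⟩ := Submodule.mem_span_singleton.1 h2
  obtain ⟨b, rfl⟩ := hs.exists_smul h1
  obtain ⟨c, rfl⟩ := hu.exists_smul h3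
  exact ⟨a, b, c, by abel⟩

lemma oneForm_ext (hs : Generates es S.Es) (hu : Generates eu S.Eu) {p : M}
    {f g : TangentSpace (𝓡 3) p →L[ℝ] ℝ} (hX : f (X p) = g (X p)) (hes : f (es p) = g (es p))
    (heu : f (eu p) = g (eu p)) : f = g := by
  refine ContinuousLinearMap.ext fun v => ?_
  obtain ⟨a, b, c, rfl⟩ := S.exists_decomp hs hu p v
  simp [hX, hes, heu]

lemma linearIndependent_frame (hs : Generates es S.Es) (hu : Generates eu S.Eu) {p : M}
    (hX : X p ≠ 0) : LinearIndependent ℝ ![X p, es p, eu p] := by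
  rw [Fintype.linearIndependent_iff]
  intro g hg
  simp [Fin.sum_univ_three] at hg
  have memX : X p ∈ Submodule.span ℝ {X p} := Submodule.mem_span_singleton_self _
  have h1 : g 1 = 0 := by
    have h : g 1 • es p ∈ S.Es p ⊓ (Submodule.span ℝ {X p} ⊔ S.Eu p) := by
      refine ⟨Submodule.smul_mem _ _ (hs.mem p), ?_⟩
      have e : g 1 • es p = (- g 0) • X p + (- g 2) • eu p := by
        rw [neg_smul, neg_smul, ← sub_eq_zero, ← hg]
        abel
      rw [e]
      exact Submodule.add_mem_sup (Submodule.smul_mem _ _ memX)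
        (Submodule.smul_mem _ _ (hu.mem p))
    rw [(S.compl_s p).inf_eq_bot, Submodule.mem_bot] at h
    exact (smul_eq_zero.1 h).resolve_right (hs p).1
  have h2 : g 2 = 0 := by
    have h : g 2 • eu p ∈ S.Eu p ⊓ (Submodule.span ℝ {X p} ⊔ S.Es p) := by
      refine ⟨Submodule.smul_mem _ _ (hu.mem p), ?_⟩
      have e : g 2 • eu p = (- g 0) • X p + (- g 1) • es p := by
        rw [neg_smul, neg_smul, ← sub_eq_zero, ← hg]
        abel
      rw [e]
      exact Submodule.add_mem_sup (Submodule.smul_mem _ _ memX)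
        (Submodule.smul_mem _ _ (hs.mem p))
    rw [(S.compl_u p).inf_eq_bot, Submodule.mem_bot] at h
    exact (smul_eq_zero.1 h).resolve_right (hu p).1
  have h0 : g 0 = 0 := by
    rw [h1, h2] at hg
    simp at hg
    exact hg.resolve_right hX
  intro i
  fin_cases i <;> assumption

/-- The flow preserves X and both line fields, so pulling back commutes with the projections of the
splitting. -/
lemma pullback_unstablePart (hφ : IsFlowOf X φ) (γ : OneForm M) (t : ℝ) (p : M) :
    pullback (φ t) (S.unstablePart γ) p = S.unstablePart (pullback (φ t) γ) p := by
  obtain ⟨es, -, hs⟩ := S.line_s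
  obtain ⟨eu, -, hu⟩ := S.line_u
  have hs : Generates es S.Es := hs
  have hu : Generates eu S.Eu := hu
  have memX (q : M) : X q ∈ Submodule.span ℝ {X q} ⊔ S.Es q :=
    Submodule.mem_sup_left (Submodule.mem_span_singleton_self _)
  refine S.oneForm_ext hs hu ?_ ?_ ?_
  · rw [S.unstablePart_apply_eq_zero _ (memX p)]
    change S.unstablePart γ (φ t p) (mfderiv (𝓡 3) (𝓡 3) (φ t) p (X p)) = 0
    rw [hφ.mfderiv_apply_velocity, S.unstablePart_apply_eq_zero _ (memX _)]
  · rw [S.unstablePart_apply_eq_zero _ (Submodule.mem_sup_right (hs.mem p))]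
    refine S.unstablePart_apply_eq_zero γ (Submodule.mem_sup_right ?_)
    rw [← S.invariant_s]
    exact Submodule.mem_map_of_mem (hs.mem p)
  · rw [S.unstablePart_apply_of_mem _ (hu.mem p)]
    refine S.unstablePart_apply_of_mem γ ?_
    rw [← S.invariant_u]
    exact Submodule.mem_map_of_mem (hu.mem p)

lemma pullback_stablePart (hφ : IsFlowOf X φ) (γ : OneForm M) (t : ℝ) (p : M) :
    pullback (φ t) (S.stablePart γ) p = S.stablePart (pullback (φ t) γ) p := by
  obtain ⟨es, -, hs⟩ := S.line_s
  obtain ⟨eu, -, hu⟩ := S.line_u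
  have hs : Generates es S.Es := hs
  have hu : Generates eu S.Eu := hu
  have memX (q : M) : X q ∈ Submodule.span ℝ {X q} ⊔ S.Eu q :=
    Submodule.mem_sup_left (Submodule.mem_span_singleton_self _)
  refine S.oneForm_ext hs hu ?_ ?_ ?_
  · rw [S.stablePart_apply_eq_zero _ (memX p)]
    change S.stablePart γ (φ t p) (mfderiv (𝓡 3) (𝓡 3) (φ t) p (X p)) = 0
    rw [hφ.mfderiv_apply_velocity, S.stablePart_apply_eq_zero _ (memX _)]
  · rw [S.stablePart_apply_of_mem _ (hs.mem p)]
    refine S.stablePart_apply_of_mem γ ?_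
    rw [← S.invariant_s]
    exact Submodule.mem_map_of_mem (hs.mem p)
  · rw [S.stablePart_apply_eq_zero _ (Submodule.mem_sup_right (hu.mem p))]
    refine S.stablePart_apply_eq_zero γ (Submodule.mem_sup_right ?_)
    rw [← S.invariant_u]
    exact Submodule.mem_map_of_mem (hu.mem p)

/-- At a fixed point, the pull-backs of γ_u are those of the smooth form γ followed by one fixed
projection. Their derivative is therefore (L_X γ)_u, and u-parts are determined by their value on
`eu`. -/
lemma isExpansionRate_unstablePart (hφ : IsFlowOf X φ) (hs : Generates es S.Es)
    (hu : Generates eu S.Eu) {γ : OneForm M} (hγ : IsSmoothForm γ)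
    (h0 : ∀ p, γ p (eu p) ≠ 0) :
    IsExpansionRate φ (S.unstablePart γ) (fun p => lieD φ γ p (eu p) / γ p (eu p)) := by
  intro p
  have h := HasDerivAt.clm_comp_const (E := R3) (F := R3) (G := ℝ)
    (hφ.hasDerivAt_pullback_zero hγ p)
    (LinearMap.toContinuousLinearMap ((S.Eu p).projection _ (S.compl_u p)))
  have e : (lieD φ γ p (eu p) / γ p (eu p)) • S.unstablePart γ p =
      S.unstablePart (lieD φ γ) p := by
    have memX : X p ∈ Submodule.span ℝ {X p} ⊔ S.Es p :=
      Submodule.mem_sup_left (Submodule.mem_span_singleton_self _)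
    have memE : es p ∈ Submodule.span ℝ {X p} ⊔ S.Es p := Submodule.mem_sup_right (hs.mem p)
    refine S.oneForm_ext hs hu ?_ ?_ ?_
    · simp [S.unstablePart_apply_eq_zero _ memX]
    · simp [S.unstablePart_apply_eq_zero _ memE]
    · simp [S.unstablePart_apply_of_mem _ (hu.mem p), h0 p]
  simp only [e, S.pullback_unstablePart hφ]
  exact h

lemma isExpansionRate_stablePart (hφ : IsFlowOf X φ) (hs : Generates es S.Es)
    (hu : Generates eu S.Eu) {γ : OneForm M} (hγ : IsSmoothForm γ)
    (h0 : ∀ p, γ p (es p) ≠ 0) :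
    IsExpansionRate φ (S.stablePart γ) (fun p => lieD φ γ p (es p) / γ p (es p)) := by
  intro p
  have h := (HasDerivAt.clm_comp_const (E := R3) (F := R3) (G := ℝ)
    (hφ.hasDerivAt_pullback_zero hγ p)
    (LinearMap.toContinuousLinearMap ((S.Es p).projection _ (S.compl_s p)))).neg
  have e : (lieD φ γ p (es p) / γ p (es p)) • S.stablePart γ p =
      S.stablePart (lieD φ γ) p := by
    have memX : X p ∈ Submodule.span ℝ {X p} ⊔ S.Eu p :=
      Submodule.mem_sup_left (Submodule.mem_span_singleton_self _)
    have memE : eu p ∈ Submodule.span ℝ {X p} ⊔ S.Eu p := Submodule.mem_sup_right (hu.mem p)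
    refine S.oneForm_ext hs hu ?_ ?_ ?_
    · simp [S.stablePart_apply_eq_zero _ memX]
    · simp [S.stablePart_apply_of_mem _ (hs.mem p), h0 p]
    · simp [S.stablePart_apply_eq_zero _ memE]
  simp only [e, S.pullback_stablePart hφ]
  exact h

end AnosovSplitting

end Splitting

/-! ### Expansion rates along orbits -/

section Rates

variable {M : Type*} [TopologicalSpace M] [ChartedSpace R3 M]
  {X : VecField M} {φ : ℝ → M → M} {e : VecField M} {E : SubspaceField M}

lemma Generates.exists_pullback_eq_mul (he : Generates e E) (hinv : ∀ t p,
      (E p).map (mfderiv (𝓡 3) (𝓡 3) (φ t) p).toLinearMap = E (φ t p)) (t : ℝ) (p : M) :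
    ∃ c : ℝ, c ≠ 0 ∧ mfderiv (𝓡 3) (𝓡 3) (φ t) p (e p) = c • e (φ t p) ∧
      ∀ γ : OneForm M, pullback (φ t) γ p (e p) = c * γ (φ t p) (e (φ t p)) := by
  obtain ⟨c, hc, h⟩ := he.exists_mfderiv_eq_smul hinv t p
  refine ⟨c, hc, h, fun γ => ?_⟩
  change γ (φ t p) (mfderiv (𝓡 3) (𝓡 3) (φ t) p (e p)) = _
  rw [h, map_smul, smul_eq_mul]

lemma Generates.pullback_ne_zero (he : Generates e E) (hinv : ∀ t p,
      (E p).map (mfderiv (𝓡 3) (𝓡 3) (φ t) p).toLinearMap = E (φ t p)) {γ : OneForm M}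
    (h0 : ∀ p, γ p (e p) ≠ 0) (t : ℝ) (p : M) : pullback (φ t) γ p (e p) ≠ 0 := by
  obtain ⟨c, hc, -, h⟩ := he.exists_pullback_eq_mul hinv t p
  rw [h]
  exact mul_ne_zero hc (h0 _)

/-- The factor by which the flow stretches `e` cancels. Quotients along the orbit can thus be
differentiated without differentiating `e`. -/
lemma Generates.div_apply_flow (he : Generates e E) (hinv : ∀ t p,
      (E p).map (mfderiv (𝓡 3) (𝓡 3) (φ t) p).toLinearMap = E (φ t p)) (γ δ : OneForm M)
    (t : ℝ) (p : M) : γ (φ t p) (e (φ t p)) / δ (φ t p) (e (φ t p)) =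
      pullback (φ t) γ p (e p) / pullback (φ t) δ p (e p) := by
  obtain ⟨c, hc, -, h⟩ := he.exists_pullback_eq_mul hinv t p
  rw [h, h, mul_div_mul_left _ _ hc]

variable [IsManifold (𝓡 3) ∞ M]

/-- The derivative of the logarithm of an expansion rate along the flow. -/
lemma Generates.isFlowDeriv_log (hφ : IsFlowOf X φ) (hX : IsSmoothField X) (he : Generates e E)
    (hinv : ∀ t p, (E p).map (mfderiv (𝓡 3) (𝓡 3) (φ t) p).toLinearMap = E (φ t p))
    {γ : OneForm M} (hγ : IsSmoothForm γ) (h0 : ∀ p, γ p (e p) ≠ 0)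
    (h1 : ∀ p, lieD φ γ p (e p) ≠ 0) :
    IsFlowDeriv φ (fun p => Real.log (lieD φ γ p (e p) / γ p (e p)))
      (fun p => lieD φ (lieD φ γ) p (e p) / lieD φ γ p (e p) -
        lieD φ γ p (e p) / γ p (e p)) := by
  intro p
  have hf := hφ.hasDerivAt_pullback hγ p (e p) 0
  have hf' := hφ.hasDerivAt_pullback (hφ.isSmoothForm_lieD hX hγ) p (e p) 0
  have hn0 := he.pullback_ne_zero hinv h0 0 p
  have hn1 := he.pullback_ne_zero hinv h1 0 p
  -- The quotient is f'/f for f(t) = (φ_t^*γ)(e p), so its logarithmic derivative is f''/f' − f'/f.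
  -- As `Real.log` is ln|·|, non-vanishing suffices.
  have h := (hf'.div hf hn0).log (div_ne_zero hn1 hn0)
  simp only [hφ.pullback_zero, Pi.div_apply] at h
  simp only [he.div_apply_flow hinv]
  refine h.congr_deriv ?_
  have := h0 p
  have := h1 p
  field_simp

/-- A line field that is expanded by the flow has positive expansion rates, as soon as they do
not vanish. -/
lemma Generates.rate_pos [CompactSpace M] (hφ : IsFlowOf X φ) (he : Generates e E)
    (hec : IsContField e)
    (hinv : ∀ t p, (E p).map (mfderiv (𝓡 3) (𝓡 3) (φ t) p).toLinearMap = E (φ t p))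
    {N : ∀ p : M, Seminorm ℝ (TangentSpace (𝓡 3) p)} (hN0 : ∀ p v, N p v = 0 → v = 0)
    (hNc : Continuous (fun v : TangentBundle (𝓡 3) M => N v.1 v.2)) {A C : ℝ} (hA : 0 < A)
    (hC : 0 < C) (hexp : ∀ p, ∀ t : ℝ, 0 ≤ t → A⁻¹ * Real.exp (C * t) * N p (e p) ≤
      N (φ t p) (mfderiv (𝓡 3) (𝓡 3) (φ t) p (e p)))
    {γ : OneForm M} (hγ : IsSmoothForm γ) (h0 : ∀ p, γ p (e p) ≠ 0)
    (h1 : ∀ p, lieD φ γ p (e p) ≠ 0) (p : M) : 0 < lieD φ γ p (e p) / γ p (e p) := by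
  set f : ℝ → ℝ := fun t => pullback (φ t) γ p (e p) with hfdef
  set f' : ℝ → ℝ := fun t => pullback (φ t) (lieD φ γ) p (e p) with hf'def
  have hf (t : ℝ) : HasDerivAt f (f' t) t := hφ.hasDerivAt_pullback hγ p (e p) t
  have hf0 (t : ℝ) : f t ≠ 0 := he.pullback_ne_zero hinv h0 t p
  have hf1 (t : ℝ) : f' t ≠ 0 := he.pullback_ne_zero hinv h1 t p
  have hF (t : ℝ) : HasDerivAt (fun t => f t ^ 2) (2 * f t * f' t) t := by
    exact ((hf t).pow 2).congr_deriv (by simp)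
  have hz : f' 0 / f 0 = lieD φ γ p (e p) / γ p (e p) := by
    simp only [hfdef, hf'def, hφ.pullback_zero]
  rw [← hz]
  by_contra hneg
  -- By Darboux, the non-vanishing derivative 2ff' of f² has constant sign on the orbit. If it is
  -- negative, |f| stays at most |f 0| for t ≥ 0.
  rcases hasDerivWithinAt_forall_lt_or_forall_gt_of_forall_ne (s := Set.univ) (m := 0)
    convex_univ (fun t _ => (hF t).hasDerivWithinAt)
    (fun t _ => mul_ne_zero (mul_ne_zero two_ne_zero (hf0 t)) (hf1 t)) with hlt | hgt
  swap
  · apply hneg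
    have h := hgt 0 (Set.mem_univ _)
    have e1 : f' 0 / f 0 = (2 * f 0 * f' 0) / (2 * f 0 ^ 2) := by
      have := hf0 0
      field_simp
    rw [e1]
    have := hf0 0
    positivity
  have hanti : Antitone fun t => f t ^ 2 := by
    refine antitone_of_deriv_nonpos (fun t => (hF t).differentiableAt) fun t => ?_
    rw [(hF t).deriv]
    exact (hlt t (Set.mem_univ _)).le
  -- Compactness bounds N by K|γ| on the line field, so a bound on |f| would contradict the
  -- exponential growth in N.
  have hcont : Continuous fun q => N q (e q) / |γ q (e q)| :=
    (hNc.comp hec).div (hγ.continuous_apply hec).abs fun q => abs_ne_zero.2 (h0 q)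
  obtain ⟨K, hK⟩ := (isCompact_range hcont).bddAbove
  have hbound (t : ℝ) (ht : 0 ≤ t) : A⁻¹ * Real.exp (C * t) * N p (e p) ≤ K * |f 0| := by
    refine (hexp p t ht).trans ?_
    obtain ⟨c, hc, hc1, hc2⟩ := he.exists_pullback_eq_mul hinv t p
    have hKq : N (φ t p) (e (φ t p)) / |γ (φ t p) (e (φ t p))| ≤ K := hK ⟨φ t p, rfl⟩
    have hpos : 0 < |γ (φ t p) (e (φ t p))| := abs_pos.2 (h0 _)
    have hKpos : 0 ≤ K := le_trans (div_nonneg (apply_nonneg _ _) hpos.le) hKq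
    rw [div_le_iff₀ hpos] at hKq
    rw [hc1, map_smul_eq_mul, Real.norm_eq_abs]
    calc |c| * N (φ t p) (e (φ t p)) ≤ |c| * (K * |γ (φ t p) (e (φ t p))|) := by gcongr
      _ = K * |f t| := by rw [hfdef]; simp only [hc2, abs_mul]; ring
      _ ≤ K * |f 0| := by
        exact mul_le_mul_of_nonneg_left (sq_le_sq.1 (hanti ht)) hKpos
  have hNp : 0 < N p (e p) :=
    lt_of_le_of_ne (apply_nonneg _ _) fun h => (he p).1 (hN0 p _ h.symm)
  have htend : Filter.Tendsto (fun t : ℝ => A⁻¹ * Real.exp (C * t) * N p (e p))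
      Filter.atTop Filter.atTop := by
    refine Filter.Tendsto.atTop_mul_const hNp ?_
    refine Filter.Tendsto.const_mul_atTop (inv_pos.2 hA) ?_
    exact Real.tendsto_exp_atTop.comp (Filter.tendsto_id.const_mul_atTop hC)
  obtain ⟨t, ht1, ht2⟩ := ((htend.eventually_gt_atTop (K * |f 0|)).and
    (Filter.eventually_ge_atTop 0)).exists
  exact absurd (hbound t ht2) (not_le.2 ht1)

end Rates

/-! ### From growth rates to domination -/

section Domination

/-- Squaring makes |f|/|g| differentiable whatever the signs; the derivative has the sign of C +
f'/f − g'/g. -/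
lemma hasDerivAt_exp_mul_sq_div {f f' g g' : ℝ → ℝ} {C t : ℝ} (hf : HasDerivAt f (f' t) t)
    (hg : HasDerivAt g (g' t) t) (hf0 : f t ≠ 0) (hg0 : g t ≠ 0) :
    HasDerivAt (fun t => Real.exp (2 * C * t) * (f t / g t) ^ 2)
      (2 * (Real.exp (2 * C * t) * (f t / g t) ^ 2) * (C + (f' t / f t - g' t / g t))) t := by
  have h1 : HasDerivAt (fun t => Real.exp (2 * C * t)) (Real.exp (2 * C * t) * (2 * C)) t := by
    simpa using ((hasDerivAt_id t).const_mul (2 * C)).exp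
  refine (h1.mul ((hf.div hg hg0).pow 2)).congr_deriv ?_
  simp only [Pi.div_apply, Pi.pow_apply, Nat.add_one_sub_one, pow_one, Nat.cast_ofNat]
  field_simp

lemma nonpos_of_hasDerivAt_of_forall_le {H : ℝ → ℝ} {d : ℝ} (h : HasDerivAt H d 0)
    (hle : ∀ t, 0 ≤ t → H t ≤ H 0) : d ≤ 0 := by
  have h1 := (hasDerivWithinAt_iff_tendsto_slope' (s := Set.Ioi (0 : ℝ)) (by simp)).1
    h.hasDerivWithinAt
  refine le_of_tendsto h1 ?_
  filter_upwards [self_mem_nhdsWithin] with t ht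
  rw [slope_def_field]
  exact div_nonpos_of_nonpos_of_nonneg (sub_nonpos.2 (hle t (le_of_lt ht)))
    (by simpa using le_of_lt ht)

lemma abs_div_le_of_sq {a b c d C t : ℝ} :
    |a| / |b| ≤ Real.exp (-C * t) * (|c| / |d|) ↔
      Real.exp (2 * C * t) * (a / b) ^ 2 ≤ (c / d) ^ 2 := by
  have e1 : Real.exp (2 * C * t) * (a / b) ^ 2 = (Real.exp (C * t) * (|a| / |b|)) ^ 2 := by
    rw [mul_pow, div_pow |a|, sq_abs, sq_abs, ← Real.exp_nat_mul, div_pow]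
    congr 2
    push_cast
    ring
  have e2 : (c / d) ^ 2 = (|c| / |d|) ^ 2 := by simp [div_pow]
  rw [e1, e2, sq_le_sq₀ (by positivity) (by positivity), neg_mul, Real.exp_neg,
    inv_mul_eq_div, le_div_iff₀ (Real.exp_pos _), mul_comm]

end Domination

/-! ### Conditions governed by the sign of (L_X α)([R, X]) -/

section Contact

variable {M : Type*} [TopologicalSpace M] [ChartedSpace R3 M]

lemma exists_eq_smul_add_of_linearIndependent {p : M} {u v w : TangentSpace (𝓡 3) p}
    (h : LinearIndependent ℝ ![u, v, w]) (x : TangentSpace (𝓡 3) p) :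
    ∃ a b c : ℝ, x = a • u + b • v + c • w := by
  let B := basisOfLinearIndependentOfCardEqFinrank h (by simp [finrank_tangentSpace])
  have hx := B.sum_repr x
  simp only [B, Fin.sum_univ_three, coe_basisOfLinearIndependentOfCardEqFinrank] at hx
  exact ⟨_, _, _, hx.symm⟩

variable [IsManifold (𝓡 3) ∞ M]
  {o : MOrientation M} {X R : VecField M} {φ : ℝ → M → M} {α : OneForm M}

lemma IsFlowOf.lieD_apply_self (hφ : IsFlowOf X φ) (hX : IsSmoothField X)
    (hα : IsSmoothForm α) (hαX : ∀ p, α p (X p) = 0) (p : M) : lieD φ α p (X p) = 0 := by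
  rw [hφ.lieD_apply hX hα hαX, extD_self]

lemma IsReeb.lieD_apply (hR : IsReeb α R) (hφ : IsFlowOf X φ) (hX : IsSmoothField X)
    (hα : IsSmoothForm α) (hαX : ∀ p, α p (X p) = 0) (p : M) : lieD φ α p (R p) = 0 := by
  rw [hφ.lieD_apply hX hα hαX, extD_swap, hR.kernel, neg_zero]

lemma IsReeb.apply_bracket (hR : IsReeb α R) (hX : IsSmoothField X)
    (hα : IsSmoothForm α) (hαX : ∀ p, α p (X p) = 0) (p : M) : α p (bracket R X p) = 0 := by
  have h := extD_of_apply_const hα hR.smooth hX hR.normalized hαX p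
  rw [hR.kernel] at h
  linarith

/-- `γ ∧ dγ` in terms of Lie derivatives, for a 1-form that vanishes on `X`. -/
lemma IsFlowOf.wedgeExtD_apply (hφ : IsFlowOf X φ) (hX : IsSmoothField X) {γ : OneForm M}
    (hγ : IsSmoothForm γ) (hγX : ∀ p, γ p (X p) = 0) (p : M) (v w : TangentSpace (𝓡 3) p) :
    wedgeExtD γ p ![X p, v, w] = γ p w * lieD φ γ p v - γ p v * lieD φ γ p w := by
  simp only [wedgeExtD, Matrix.cons_val_zero, Matrix.cons_val_one, Matrix.cons_val, hγX,
    hφ.lieD_apply hX hγ hγX]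
  rw [extD_swap γ p w (X p)]
  ring

/-- Only γ(w) dγ(X, R) survives, and dγ(X, R) = −γ([X, R]). -/
lemma wedgeExtD_apply_of_mem_ker {γ : OneForm M} (hγ : IsSmoothForm γ) (hX : IsSmoothField X)
    (hR : IsSmoothField R) (hγX : ∀ p, γ p (X p) = 0) (hγR : ∀ p, γ p (R p) = 0) (p : M)
    (w : TangentSpace (𝓡 3) p) :
    wedgeExtD γ p ![X p, R p, w] = γ p w * γ p (bracket R X p) := by
  have h := extD_of_apply_const hγ hX hR hγX hγR p
  have hb : bracket X R p = - bracket R X p := VectorField.mlieBracket_swap_apply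
  rw [hb, map_neg, neg_neg] at h
  simp [wedgeExtD, hγX, hγR, h]

/-- `φ` is the flow of a smooth vector field `X`, everywhere tangent to the kernel of the positive
contact form `α` with Reeb field `R`, and with `L_X α` nowhere zero. -/
structure IsLegendrianFlow (o : MOrientation M) (X : VecField M) (φ : ℝ → M → M) (α : OneForm M)
    (R : VecField M) : Prop where
  flow : IsFlowOf X φ
  smooth : IsSmoothField X
  reeb : IsReeb α R
  pos : IsPosContactForm o α
  apply_eq_zero : ∀ p, α p (X p) = 0
  lieD_ne_zero : ∀ p, lieD φ α p ≠ 0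

namespace IsLegendrianFlow

variable (h : IsLegendrianFlow o X φ α R)
include h

lemma isSmoothForm_lieD : IsSmoothForm (lieD φ α) := h.flow.isSmoothForm_lieD h.smooth h.pos.1

lemma lieD_apply_X (p : M) : lieD φ α p (X p) = 0 :=
  h.flow.lieD_apply_self h.smooth h.pos.1 h.apply_eq_zero p

lemma lieD_apply_R (p : M) : lieD φ α p (R p) = 0 :=
  h.reeb.lieD_apply h.flow h.smooth h.pos.1 h.apply_eq_zero p

lemma lieD_apply (p : M) (v : TangentSpace (𝓡 3) p) : lieD φ α p v = extD α p (X p) v :=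
  h.flow.lieD_apply h.smooth h.pos.1 h.apply_eq_zero p v

lemma apply_bracket (p : M) : α p (bracket R X p) = 0 :=
  h.reeb.apply_bracket h.smooth h.pos.1 h.apply_eq_zero p

lemma wedgeExtD_reeb_frame (p : M) (w : TangentSpace (𝓡 3) p) :
    wedgeExtD α p ![X p, R p, w] = - lieD φ α p w := by
  rw [h.flow.wedgeExtD_apply h.smooth h.pos.1 h.apply_eq_zero, h.lieD_apply_R,
    h.reeb.normalized]
  ring

/-- Any w on which L_X α is non-zero works, since α ∧ dα takes the value −(L_X α)(w) on (X, R, w).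
-/
lemma exists_transverse (p : M) : ∃ w, lieD φ α p w ≠ 0 ∧
    LinearIndependent ℝ ![X p, R p, w] := by
  by_contra! hw
  apply h.lieD_ne_zero p
  refine ContinuousLinearMap.ext fun w => ?_
  by_contra h0
  refine hw w h0 (linearIndependent_of_wedgeExtD_ne_zero (γ := α) ?_)
  rw [h.wedgeExtD_reeb_frame]
  exact neg_ne_zero.2 h0

lemma spanField_eq_kerField : spanField X R = kerField (lieD φ α) := by
  funext p
  obtain ⟨w, hw, hli⟩ := h.exists_transverse p
  apply le_antisymm
  · refine Submodule.span_le.2 ?_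
    rintro v (rfl | rfl)
    · exact h.lieD_apply_X p
    · exact h.lieD_apply_R p
  · intro v hv
    have hv : lieD φ α p v = 0 := hv
    obtain ⟨a, b, c, rfl⟩ := exists_eq_smul_add_of_linearIndependent hli v
    simp only [map_add, map_smul, h.lieD_apply_X, h.lieD_apply_R, smul_eq_mul, mul_zero,
      zero_add, mul_eq_zero, hw, or_false] at hv
    rw [hv, zero_smul, add_zero]
    exact Submodule.mem_span_pair.2 ⟨a, b, rfl⟩

lemma isNegContactForm_lieD_iff :
    IsNegContactForm o (lieD φ α) ↔ ∀ p, 0 < lieD φ α p (bracket R X p) := by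
  choose w hw hli using h.exists_transverse
  rw [h.pos.isNegContactForm_iff h.isSmoothForm_lieD (fun p => ![X p, R p, w p]) (fun p => by
    rw [h.wedgeExtD_reeb_frame]; exact neg_ne_zero.2 (hw p))]
  refine forall_congr' fun p => ?_
  rw [h.wedgeExtD_reeb_frame, wedgeExtD_apply_of_mem_ker h.isSmoothForm_lieD h.smooth
    h.reeb.smooth h.lieD_apply_X h.lieD_apply_R]
  have hsq : 0 < lieD φ α p (w p) ^ 2 := by
    have := hw p
    positivity
  have e : lieD φ α p (w p) * lieD φ α p (bracket R X p) * - lieD φ α p (w p) =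
    - (lieD φ α p (w p) ^ 2 * lieD φ α p (bracket R X p)) := by ring
  rw [e, neg_lt_zero, mul_pos_iff_of_pos_left hsq]

lemma isNegContactStructure_span_iff :
    IsNegContactStructure o (spanField X R) ↔ ∀ p, 0 < lieD φ α p (bracket R X p) := by
  constructor
  · rintro ⟨γ, hγ, hker⟩ p
    have hmem (q : M) (v : TangentSpace (𝓡 3) q) (hv : v ∈ spanField X R q) : γ q v = 0 := by
      rw [hker] at hv
      exact hv
    have hγX (q : M) : γ q (X q) = 0 := hmem q _ (Submodule.subset_span (by simp))
    have hγR (q : M) : γ q (R q) = 0 := hmem q _ (Submodule.subset_span (by simp))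
    choose w hw hli using h.exists_transverse
    have hneg := (h.pos.isNegContactForm_iff hγ.1 (fun p => ![X p, R p, w p]) (fun p => by
      rw [h.wedgeExtD_reeb_frame]; exact neg_ne_zero.2 (hw p))).1 hγ p
    rw [h.wedgeExtD_reeb_frame, wedgeExtD_apply_of_mem_ker hγ.1 h.smooth h.reeb.smooth hγX hγR]
      at hneg
    -- Both γ and L_X α kill X and R, so only the coefficient c of w in [R, X] matters. The
    -- hypothesis becomes −c (L_X α)(w) γ(w)² < 0.
    obtain ⟨a, b, c, hbr⟩ := exists_eq_smul_add_of_linearIndependent (hli p) (bracket R X p)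
    rw [hbr] at hneg ⊢
    simp only [map_add, map_smul, h.lieD_apply_X, h.lieD_apply_R, hγX, hγR, smul_eq_mul, mul_zero,
      zero_add] at hneg ⊢
    nlinarith [sq_nonneg (γ p (w p))]
  · intro h7
    exact ⟨lieD φ α, h.isNegContactForm_lieD_iff.2 h7, h.spanField_eq_kerField⟩

lemma isCoorientedBasis_iff :
    IsCoorientedBasis α X (bracket R X) ↔ ∀ p, 0 < lieD φ α p (bracket R X p) := by
  refine forall_congr' fun p => ?_
  rw [h.lieD_apply]
  refine ⟨fun h5 => h5.2.2, fun h7 => ?_⟩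
  have hli : LinearIndependent ℝ ![X p, bracket R X p] := by
    rw [LinearIndependent.pair_iff]
    intro a b hab
    -- Pairing the relation under dα with X isolates b, and with [R, X] isolates a.
    have h1 := congrArg (fun v => extD α p (X p) v) hab
    have h2 := congrArg (fun v => extD α p v (bracket R X p)) hab
    simp only [extD_add_right, extD_smul_right, extD_add_left, extD_smul_left, extD_self,
      ← zero_smul ℝ (X p), zero_mul, mul_zero, zero_add, add_zero, mul_eq_zero, h7.ne', or_false]
      at h1 h2
    exact ⟨h2, h1⟩
  refine ⟨hli, ?_, h7⟩
  have hle : spanField X (bracket R X) p ≤ kerField α p := by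
    refine Submodule.span_le.2 ?_
    rintro v (rfl | rfl)
    · exact h.apply_eq_zero p
    · exact h.apply_bracket p
  -- The span has dimension 2, and ker α has dimension at most 2 because α(R) = 1.
  refine Submodule.eq_of_le_of_finrank_le hle ?_
  have h1 : Module.finrank ℝ (spanField X (bracket R X) p) = 2 := by
    have := finrank_span_eq_card hli
    rwa [Matrix.range_cons_cons_empty, Fintype.card_fin] at this
  have hne : kerField α p ≠ ⊤ := by
    intro ht
    have : R p ∈ kerField α p := by rw [ht]; trivial
    have h0 : α p (R p) = 0 := this
    rw [h.reeb.normalized] at h0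
    exact one_ne_zero h0
  have h2 := Submodule.finrank_lt hne
  rw [finrank_tangentSpace] at h2
  omega

lemma isPosBasis_iff :
    (∀ p, IsPosBasis (o.at_ p) ![R p, bracket X R p, X p]) ↔
      ∀ p, 0 < lieD φ α p (bracket R X p) := by
  refine forall_congr' fun p => ?_
  have hb : bracket X R p = - bracket R X p := VectorField.mlieBracket_swap_apply
  rw [h.pos.isPosBasis_iff, h.lieD_apply, hb]
  have e : wedgeExtD α p ![R p, - bracket R X p, X p] = extD α p (X p) (bracket R X p) := by
    simp only [wedgeExtD, Matrix.cons_val_zero, Matrix.cons_val_one, Matrix.cons_val, map_neg,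
      h.apply_eq_zero, h.apply_bracket, h.reeb.normalized]
    rw [← neg_one_smul ℝ (bracket R X p), extD_smul_left, extD_swap]
    ring
  rw [e]

lemma isSupportingBiContact_iff (hX0 : ∀ p, X p ≠ 0) :
    IsSupportingBiContact o X (spanField X R) (kerField α) ↔
      IsNegContactStructure o (spanField X R) := by
  refine ⟨fun h2 => h2.biContact.neg, fun hneg => ⟨⟨hneg, ⟨α, h.pos, rfl⟩, fun p => ?_⟩, hX0,
    fun p => ⟨Submodule.subset_span (by simp), h.apply_eq_zero p⟩⟩⟩
  rw [eq_top_iff]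
  intro v _
  have e : v = α p v • R p + (v - α p v • R p) := by abel
  rw [e]
  refine Submodule.add_mem_sup (Submodule.smul_mem _ _ (Submodule.subset_span (by simp))) ?_
  change α p (v - α p v • R p) = 0
  rw [map_sub, map_smul, h.reeb.normalized, smul_eq_mul, mul_one, sub_self]

end IsLegendrianFlow

end Contact

/-! ### Adapted forms: signs of the rates and their comparison -/

/-- Here a and b are the values of α and L_X α on `es`, `eu`, and y, z are the coefficients of R
there. `h1` is the quadrant condition, `h0` is (L_X α)(R) = 0, and `hne` is the contact condition.
-/
lemma mul_div_neg_of_reeb {as au bs bu y z : ℝ} (h1 : 0 < y * as * (z * au))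
    (h0 : y * bs + z * bu = 0) (hne : au * bs - as * bu ≠ 0) :
    as ≠ 0 ∧ au ≠ 0 ∧ bs ≠ 0 ∧ bu ≠ 0 ∧ bs / as * (bu / au) < 0 := by
  have has : as ≠ 0 := by rintro rfl; simp at h1
  have hau : au ≠ 0 := by rintro rfl; simp at h1
  have hy : y ≠ 0 := by rintro rfl; simp at h1
  have hz : z ≠ 0 := by rintro rfl; simp at h1
  have hbu : bu ≠ 0 := by
    rintro rfl
    have : bs = 0 := by simpa [hy] using h0
    simp [this] at hne
  have hbs : bs ≠ 0 := by
    rintro rfl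
    have : bu = 0 := by simpa [hz] using h0
    exact hbu this
  refine ⟨has, hau, hbs, hbu, ?_⟩
  have e : bs / as * (bu / au) = - ((z * bu) ^ 2 / (y * as * (z * au))) := by
    have : bs = - (z * bu) / y := by rw [eq_div_iff hy]; linarith
    rw [this]
    field_simp
  rw [e, neg_lt_zero]
  positivity

/-- With c the values of the second Lie derivative, the product is a multiple of cs/bs − cu/bu. The
multiplier is positive because bs/as < 0 < bu/au. -/
lemma mul_neg_iff_div_lt_div {as au bs bu cs cu : ℝ} (has : as ≠ 0) (hau : au ≠ 0)
    (hs : bs / as < 0) (hu : 0 < bu / au) :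
    (bu * cs - bs * cu) * (au * bs - as * bu) < 0 ↔ cs / bs < cu / bu := by
  have hbs : bs ≠ 0 := by rintro rfl; simp at hs
  have hbu : bu ≠ 0 := by rintro rfl; simp at hu
  have e : (bu * cs - bs * cu) * (au * bs - as * bu) =
      ((as * au) ^ 2 * (-(bs / as)) * (bu / au) * (bu / au - bs / as)) *
        (cs / bs - cu / bu) := by
    field_simp
    ring
  have hk : 0 < (as * au) ^ 2 * (-(bs / as)) * (bu / au) * (bu / au - bs / as) := by
    have : 0 < - (bs / as) := neg_pos.2 hs
    have : 0 < bu / au - bs / as := by linarith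
    positivity
  rw [e]
  constructor
  · intro h
    have := neg_of_mul_neg_right h hk.le
    linarith
  · intro h
    exact mul_neg_of_pos_of_neg hk (by linarith)

section Adapted

variable {M : Type*} [TopologicalSpace M] [ChartedSpace R3 M] [IsManifold (𝓡 3) ∞ M]
  {o : MOrientation M} {X R : VecField M} {φ : ℝ → M → M} {α : OneForm M}

namespace AnosovSplitting

variable (S : AnosovSplitting X φ) {es eu : VecField M}

lemma inducedNorm_apply_of_mem_Es (γ : OneForm M) {p : M} {v : TangentSpace (𝓡 3) p}
    (hv : v ∈ S.Es p) : S.inducedNorm γ p v = |γ p v| := by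
  have h1 := S.unstablePart_apply_eq_zero γ (Submodule.mem_sup_right hv)
  have h2 := S.stablePart_apply_of_mem γ hv
  change |S.unstablePart γ p v| + |S.stablePart γ p v| = _
  rw [h1, h2, abs_zero, zero_add, abs_neg]

lemma inducedNorm_apply_of_mem_Eu (γ : OneForm M) {p : M} {v : TangentSpace (𝓡 3) p}
    (hv : v ∈ S.Eu p) : S.inducedNorm γ p v = |γ p v| := by
  have h1 := S.stablePart_apply_eq_zero γ (Submodule.mem_sup_right hv)
  have h2 := S.unstablePart_apply_of_mem γ hv
  change |S.unstablePart γ p v| + |S.stablePart γ p v| = _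
  rw [h1, h2, abs_zero, add_zero]

lemma inducedNorm_eq_zero (hs : Generates es S.Es) (hu : Generates eu S.Eu) {γ : OneForm M}
    {p : M} (h0s : γ p (es p) ≠ 0) (h0u : γ p (eu p) ≠ 0) {v : TangentSpace (𝓡 3) p}
    (hv : v ∈ S.Es p ⊔ S.Eu p) (h : S.inducedNorm γ p v = 0) : v = 0 := by
  obtain ⟨v1, h1, v2, h2, rfl⟩ := Submodule.mem_sup.1 hv
  have h' : |S.unstablePart γ p (v1 + v2)| + |S.stablePart γ p (v1 + v2)| = 0 := h
  rw [map_add, map_add, S.unstablePart_apply_eq_zero γ (Submodule.mem_sup_right h1),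
    S.unstablePart_apply_of_mem γ h2, S.stablePart_apply_of_mem γ h1,
    S.stablePart_apply_eq_zero γ (Submodule.mem_sup_right h2), zero_add, add_zero, abs_neg] at h'
  obtain ⟨b, rfl⟩ := hs.exists_smul h1
  obtain ⟨c, rfl⟩ := hu.exists_smul h2
  have hc : γ p (c • eu p) = 0 := abs_eq_zero.1 (by
    linarith [abs_nonneg (γ p (c • eu p)), abs_nonneg (γ p (b • es p))])
  have hb : γ p (b • es p) = 0 := abs_eq_zero.1 (by
    linarith [abs_nonneg (γ p (c • eu p)), abs_nonneg (γ p (b • es p))])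
  rw [map_smul, smul_eq_mul, mul_eq_zero] at hb hc
  rw [hb.resolve_right h0s, hc.resolve_right h0u]
  simp

lemma mfderiv_mem_Es {t : ℝ} {p : M} {v : TangentSpace (𝓡 3) p} (hv : v ∈ S.Es p) :
    mfderiv (𝓡 3) (𝓡 3) (φ t) p v ∈ S.Es (φ t p) := by
  rw [← S.invariant_s]
  exact Submodule.mem_map_of_mem hv

lemma mfderiv_mem_Eu {t : ℝ} {p : M} {v : TangentSpace (𝓡 3) p} (hv : v ∈ S.Eu p) :
    mfderiv (𝓡 3) (𝓡 3) (φ t) p v ∈ S.Eu (φ t p) := by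
  rw [← S.invariant_u]
  exact Submodule.mem_map_of_mem hv

/-- The norm induced by a 1-form is projectively adapted if and only if the expansion rate of its
stable part is smaller than that of its unstable part. -/
lemma isProjAdapted_inducedNorm_iff [CompactSpace M] [Nonempty M] (hφ : IsFlowOf X φ)
    (hX : IsSmoothField X) (hs : Generates es S.Es) (hu : Generates eu S.Eu)
    (hsc : IsContField es) (huc : IsContField eu)
    {γ : OneForm M} (hγ : IsSmoothForm γ) (h0s : ∀ p, γ p (es p) ≠ 0)
    (h0u : ∀ p, γ p (eu p) ≠ 0) :
    S.IsProjAdapted (S.inducedNorm γ) ↔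
      ∀ p, lieD φ γ p (es p) / γ p (es p) < lieD φ γ p (eu p) / γ p (eu p) := by
  have hder (C : ℝ) (p : M) (t : ℝ) := hasDerivAt_exp_mul_sq_div (C := C)
    (f := fun t => pullback (φ t) γ p (es p)) (f' := fun t => pullback (φ t) (lieD φ γ) p (es p))
    (g := fun t => pullback (φ t) γ p (eu p)) (g' := fun t => pullback (φ t) (lieD φ γ) p (eu p))
    (hφ.hasDerivAt_pullback hγ p (es p) t) (hφ.hasDerivAt_pullback hγ p (eu p) t)
    (hs.pullback_ne_zero S.invariant_s h0s t p) (hu.pullback_ne_zero S.invariant_u h0u t p)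
  constructor
  · rintro ⟨-, C, hC, hdom⟩ p
    have hle (t : ℝ) (ht : 0 ≤ t) := hdom p t ht (es p) (hs.mem p) (eu p) (hu.mem p) (hu p).1
    simp only [S.inducedNorm_apply_of_mem_Es γ (S.mfderiv_mem_Es (hs.mem p)),
      S.inducedNorm_apply_of_mem_Eu γ (S.mfderiv_mem_Eu (hu.mem p)),
      S.inducedNorm_apply_of_mem_Es γ (hs.mem p),
      S.inducedNorm_apply_of_mem_Eu γ (hu.mem p), abs_div_le_of_sq] at hle
    -- Domination with immediate effect puts the maximum over t ≥ 0 at t = 0, so the derivative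
    -- there is at most 0; C > 0 then makes the inequality strict.
    have h := nonpos_of_hasDerivAt_of_forall_le (hder C p 0) (fun t ht => by
      simp only [hφ.pullback_zero, mul_zero, Real.exp_zero, one_mul]
      exact hle t ht)
    simp only [hφ.pullback_zero, mul_zero, Real.exp_zero, one_mul] at h
    have hq : 0 < 2 * (γ p (es p) / γ p (eu p)) ^ 2 := by
      have := h0s p
      have := h0u p
      positivity
    have := nonpos_of_mul_nonpos_right h hq
    linarith
  · intro hlt
    refine ⟨fun p v hv h0 => S.inducedNorm_eq_zero hs hu (h0s p) (h0u p) hv h0, ?_⟩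
    have hη := hφ.isSmoothForm_lieD hX hγ
    have hcont : Continuous fun p => lieD φ γ p (es p) / γ p (es p) -
        lieD φ γ p (eu p) / γ p (eu p) :=
      ((hη.continuous_apply hsc).div (hγ.continuous_apply hsc) h0s).sub
        ((hη.continuous_apply huc).div (hγ.continuous_apply huc) h0u)
    -- The constant C is the smallest gap between the two rates; it is attained, hence positive.
    obtain ⟨q, -, hq⟩ := isCompact_univ.exists_isMaxOn Set.univ_nonempty hcont.continuousOn
    set C := lieD φ γ q (eu q) / γ q (eu q) - lieD φ γ q (es q) / γ q (es q) with hCdef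
    have hmax (p : M) : C + (lieD φ γ p (es p) / γ p (es p) -
        lieD φ γ p (eu p) / γ p (eu p)) ≤ 0 := by
      have : lieD φ γ p (es p) / γ p (es p) - lieD φ γ p (eu p) / γ p (eu p) ≤
        lieD φ γ q (es q) / γ q (es q) - lieD φ γ q (eu q) / γ q (eu q) := hq (Set.mem_univ p)
      linarith
    refine ⟨C, sub_pos.2 (hlt q), fun p t ht v hv w hw hw0 => ?_⟩
    rw [S.inducedNorm_apply_of_mem_Es γ (S.mfderiv_mem_Es hv),
      S.inducedNorm_apply_of_mem_Eu γ (S.mfderiv_mem_Eu hw),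
      S.inducedNorm_apply_of_mem_Es γ hv, S.inducedNorm_apply_of_mem_Eu γ hw, abs_div_le_of_sq]
    obtain ⟨b, rfl⟩ := hs.exists_smul hv
    obtain ⟨c, rfl⟩ := hu.exists_smul hw
    have hanti : Antitone fun t => Real.exp (2 * C * t) *
        (pullback (φ t) γ p (es p) / pullback (φ t) γ p (eu p)) ^ 2 := by
      refine antitone_of_deriv_nonpos (fun t => (hder C p t).differentiableAt) fun t => ?_
      rw [(hder C p t).deriv]
      refine mul_nonpos_of_nonneg_of_nonpos (by positivity) ?_
      rw [← hs.div_apply_flow S.invariant_s, ← hu.div_apply_flow S.invariant_u]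
      exact hmax _
    have h := hanti ht
    simp only [hφ.pullback_zero, mul_zero, Real.exp_zero, one_mul] at h
    have e1 : γ (φ t p) (mfderiv (𝓡 3) (𝓡 3) (φ t) p (b • es p)) =
        b * pullback (φ t) γ p (es p) := (map_smul (pullback (φ t) γ p) b (es p) :)
    have e2 : γ (φ t p) (mfderiv (𝓡 3) (𝓡 3) (φ t) p (c • eu p)) =
        c * pullback (φ t) γ p (eu p) := (map_smul (pullback (φ t) γ p) c (eu p) :)
    rw [e1, e2, map_smul, map_smul, smul_eq_mul, smul_eq_mul, mul_div_mul_comm, mul_div_mul_comm,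
      mul_pow, mul_pow]
    have := mul_le_mul_of_nonneg_left h (sq_nonneg (b / c))
    linarith

end AnosovSplitting

/-- Where L_X α vanished, α ∧ dα would vanish on the frame (X, e_s, e_u). -/
lemma AnosovSplitting.IsAdapted.isLegendrianFlow {S : AnosovSplitting X φ}
    (hα : S.IsAdapted o α R) (hX : IsSmoothField X) (hφ : IsFlowOf X φ) (hR : IsReeb α R) :
    IsLegendrianFlow o X φ α R := by
  obtain ⟨⟨hpos, ξ, hξ⟩, -⟩ := hα
  have hαX (p : M) : α p (X p) = 0 := (hξ.mem p).2
  refine ⟨hφ, hX, hR, hpos, hαX, fun p h0 => ?_⟩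
  obtain ⟨es, -, hs⟩ := S.line_s
  obtain ⟨eu, -, hu⟩ := S.line_u
  have hli := S.linearIndependent_frame (es := es) (eu := eu) hs hu (hξ.ne_zero p)
  refine hpos.wedgeExtD_ne_zero hli ?_
  rw [hφ.wedgeExtD_apply hX hpos.1 hαX, h0]
  simp

lemma AnosovSplitting.IsAdapted.rates {S : AnosovSplitting X φ} {es eu : VecField M}
    (hα : S.IsAdapted o α R) (h : IsLegendrianFlow o X φ α R)
    (hs : Generates es S.Es) (hu : Generates eu S.Eu) (p : M) :
    α p (es p) ≠ 0 ∧ α p (eu p) ≠ 0 ∧ lieD φ α p (es p) ≠ 0 ∧ lieD φ α p (eu p) ≠ 0 ∧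
      lieD φ α p (es p) / α p (es p) * (lieD φ α p (eu p) / α p (eu p)) < 0 := by
  obtain ⟨⟨hpos, ξ, hξ⟩, hquad⟩ := hα
  obtain ⟨x, y, z, hRp⟩ := S.exists_decomp hs hu p (R p)
  have hw := hpos.wedgeExtD_ne_zero (S.linearIndependent_frame hs hu (hξ.ne_zero p))
  rw [h.flow.wedgeExtD_apply h.smooth hpos.1 h.apply_eq_zero] at hw
  have h0 := h.lieD_apply_R p
  have hq := hquad p
  rw [hRp] at h0 hq
  have memX : X p ∈ Submodule.span ℝ {X p} := Submodule.mem_span_singleton_self _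
  simp only [map_add, map_smul, smul_eq_mul, h.lieD_apply_X, mul_zero, zero_add] at h0
  simp only [map_add, map_smul, smul_eq_mul,
    S.stablePart_apply_eq_zero α (Submodule.mem_sup_left memX),
    S.unstablePart_apply_eq_zero α (Submodule.mem_sup_left memX),
    S.stablePart_apply_of_mem α (hs.mem p), S.unstablePart_apply_of_mem α (hu.mem p),
    S.stablePart_apply_eq_zero α (Submodule.mem_sup_right (hu.mem p)),
    S.unstablePart_apply_eq_zero α (Submodule.mem_sup_right (hs.mem p)), mul_zero, zero_add,
    add_zero] at hq
  exact mul_div_neg_of_reeb (y := y) (z := z) (by linarith) h0 hw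

/-- `L_X α` is a negative contact form if and only if its expansion rates are dominated. -/
lemma IsLegendrianFlow.isNegContactForm_lieD_iff_rates (h : IsLegendrianFlow o X φ α R)
    (S : AnosovSplitting X φ) {es eu : VecField M} (hs : Generates es S.Es)
    (hu : Generates eu S.Eu) (hX0 : ∀ p, X p ≠ 0) (h0s : ∀ p, α p (es p) ≠ 0)
    (h0u : ∀ p, α p (eu p) ≠ 0) (hrs : ∀ p, lieD φ α p (es p) / α p (es p) < 0)
    (hru : ∀ p, 0 < lieD φ α p (eu p) / α p (eu p)) :
    IsNegContactForm o (lieD φ α) ↔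
      ∀ p, lieD φ (lieD φ α) p (es p) / lieD φ α p (es p) <
        lieD φ (lieD φ α) p (eu p) / lieD φ α p (eu p) := by
  rw [h.pos.isNegContactForm_iff h.isSmoothForm_lieD (fun p => ![X p, es p, eu p])
    (fun p => h.pos.wedgeExtD_ne_zero (S.linearIndependent_frame hs hu (hX0 p)))]
  refine forall_congr' fun p => ?_
  rw [h.flow.wedgeExtD_apply h.smooth h.isSmoothForm_lieD h.lieD_apply_X,
    h.flow.wedgeExtD_apply h.smooth h.pos.1 h.apply_eq_zero]
  exact mul_neg_iff_div_lt_div (h0s p) (h0u p) (hrs p) (hru p)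

end Adapted

end AnosovContact

end

open AnosovContact
theorem proposition3p5 {M : Type*} [TopologicalSpace M] [T2Space M] [CompactSpace M]
    [ConnectedSpace M] [ChartedSpace R3 M] [IsManifold (𝓡 3) ∞ M]
    (o : MOrientation M)
    (X : VecField M) (hX : IsSmoothField X)
    (φ : ℝ → M → M) (hφ : IsFlowOf X φ)
    (S : AnosovSplitting X φ)
    (α : OneForm M) (R : VecField M) (hR : IsReeb α R)
    (hα : S.IsAdapted o α R) :
    ∃ ru rs Xlnru Xlnrs : M → ℝ,
      (IsExpansionRate φ (S.unstablePart α) ru ∧ IsExpansionRate φ (S.stablePart α) rs ∧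
        (∀ p, rs p < 0 ∧ 0 < ru p) ∧
        IsFlowDeriv φ (fun p => Real.log (ru p)) Xlnru ∧
        IsFlowDeriv φ (fun p => Real.log (-rs p)) Xlnrs) ∧
      List.TFAE [
        IsStronglyAdapted o X α R,
        IsSupportingBiContact o X (spanField X R) (kerField α),
        IsNegContactForm o (lieD φ α),
        S.IsProjAdapted (S.inducedNorm (lieD φ α)),
        IsCoorientedBasis α X (bracket R X),
        ∀ p, IsPosBasis (o.at_ p) ![R p, bracket X R p, X p],
        ∀ p, 0 < lieD φ α p (bracket R X p),
        ∀ p, rs p + Xlnrs p < ru p + Xlnru p] := by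
  obtain ⟨es, hsc, hs⟩ := S.line_s
  obtain ⟨eu, huc, hu⟩ := S.line_u
  have hs : Generates es S.Es := hs
  have hu : Generates eu S.Eu := hu
  have h := hα.isLegendrianFlow hX hφ hR
  have hX0 : ∀ p, X p ≠ 0 := hα.1.2.choose_spec.ne_zero
  have hrates := hα.rates h hs hu
  have hαs p := (hrates p).1
  have hαu p := (hrates p).2.1
  have hβs p := (hrates p).2.2.1
  have hβu p := (hrates p).2.2.2.1
  -- Hyperbolicity is needed on E^u only: the sign of the stable rate then follows from r_s r_u < 0.
  have hru : ∀ p, 0 < lieD φ α p (eu p) / α p (eu p) := by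
    obtain ⟨N, hN0, hNc, A, C, hA, hC, hexp⟩ := S.hyperbolic
    exact hu.rate_pos hφ huc S.invariant_u hN0 hNc hA hC
      (fun p t ht => (hexp p t ht).2 _ (hu.mem p)) h.pos.1 hαu hβu
  have hrs : ∀ p, lieD φ α p (es p) / α p (es p) < 0 := fun p =>
    neg_of_mul_neg_left (hrates p).2.2.2.2 (hru p).le
  have hlog := hs.isFlowDeriv_log hφ hX S.invariant_s h.pos.1 hαs hβs
  simp only [← Real.log_neg_eq_log (lieD φ α _ (es _) / _)] at hlog
  refine ⟨fun p => lieD φ α p (eu p) / α p (eu p), fun p => lieD φ α p (es p) / α p (es p),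
    _, _, ⟨S.isExpansionRate_unstablePart hφ hs hu h.pos.1 hαu,
      S.isExpansionRate_stablePart hφ hs hu h.pos.1 hαs, fun p => ⟨hrs p, hru p⟩,
      hu.isFlowDeriv_log hφ hX S.invariant_u h.pos.1 hαu hβu, hlog⟩, ?_⟩
  -- Here r + X·ln|r| collapses to the rate of L_X α, since the derivative of ln|r| is that rate
  -- minus r.
  simp only [add_sub_cancel]
  tfae_have 1 ↔ 7 := by
    rw [← h.isNegContactStructure_span_iff]
    exact ⟨fun h1 => h1.2, fun h1 => ⟨hα.1, h1⟩⟩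
  tfae_have 2 ↔ 7 := by
    rw [h.isSupportingBiContact_iff hX0, h.isNegContactStructure_span_iff]
  tfae_have 3 ↔ 7 := h.isNegContactForm_lieD_iff
  tfae_have 4 ↔ 8 :=
    S.isProjAdapted_inducedNorm_iff hφ hX hs hu hsc huc h.isSmoothForm_lieD hβs hβu
  tfae_have 5 ↔ 7 := h.isCoorientedBasis_iff
  tfae_have 6 ↔ 7 := h.isPosBasis_iff
  tfae_have 3 ↔ 8 := h.isNegContactForm_lieD_iff_rates S hs hu hX0 hαs hαu hrs hru
  tfae_finish
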